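/- Write $\mathcal{G}f(x,\omega)=\int_{\mathbb{R}} f(t)\,\varphi(t-x)\,e^{-2\pi i t\omega}\,dt$, with $\varphi(t)=2^{1/4}e^{-\pi t^2}$, for the Gabor transform of $f\in L^2(\mathbb{R})=L^2(\mathbb{R};\mathbb{C})$, viewed as a function of $z=x+i\omega\in\mathbb{C}$. Let $\|u\|_{H^1(\Omega)}=\big(\|u\|_{L^2(\Omega)}^2+\|\partial_x u\|_{L^2(\Omega)}^2+\|\partial_\omega u\|_{L^2(\Omega)}^2\big)^{1/2}$, with weak derivatives. Let $\Omega\subseteq\mathbb{C}$ be a bounded domain (non-empty, open, connected) with continuous boundary, i.e. near each boundary point, after a rigid motion, $\Omega$ is the region strictly below the graph of a continuous function (for example, any bounded Lipschitz domain). Let $f\in L^2(\mathbb{R})$ be such that either $f=0$ or $\mathcal{G}f$ has no zeros on $\partial\Omega$ (zeros of $\mathcal{G}f$ inside $\Omega$ are allowed). Then there is a finite constant $C=C(f,\Omega)$ such that for every $g\in L^2(\mathbb{R})$ the function $|\mathcal{G}f|-|\mathcal{G}g|$ belongs to $H^1(\Omega)$ and $$\inf_{|\lambda|=1}\|\mathcal{G}f-\lambda\,\mathcal{G}g\|_{H^1(\Omega)}\le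 C\,\big\||\mathcal{G}f|-|\mathcal{G}g|\big\|_{H^1(\Omega)}.$$ -/

import Mathlib

noncomputable section

/-- The `L²`-normalised Gaussian window on the real line. -/
def gaussianWindow (t : ℝ) : ℝ := (2 : ℝ) ^ (1 / 4 : ℝ) * Real.exp (-Real.pi * t ^ 2)

/-- The Gabor transform of `f ∈ L²(ℝ)`, i.e. the short-time Fourier transform with Gaussian
window, at the point `z = x + i ω` of the time-frequency plane. -/
def gaborTransform (f : MeasureTheory.Lp ℂ 2 (MeasureTheory.volume : MeasureTheory.Measure ℝ))
    (z : ℂ) : ℂ :=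
  ∫ t : ℝ, f t * (starRingEnd ℂ) (gaussianWindow (t - z.re) : ℂ) *
    Complex.exp (-2 * Real.pi * Complex.I * t * z.im)

/-- `v` is the weak derivative of `u` in the direction `e` on the open set `Ω ⊆ ℂ = ℝ²`. -/
def HasWeakDerivOn {E : Type*} [NormedAddCommGroup E] [NormedSpace ℝ E]
    (Ω : Set ℂ) (e : ℂ) (u v : ℂ → E) : Prop :=
  MeasureTheory.LocallyIntegrableOn u Ω ∧ MeasureTheory.LocallyIntegrableOn v Ω ∧
    ∀ φ : ℂ → ℝ, ContDiff ℝ ((⊤ : ℕ∞) : WithTop ℕ∞) φ → HasCompactSupport φ → tsupport φ ⊆ Ω →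
      ∫ z in Ω, (fderiv ℝ φ z e) • u z = -∫ z in Ω, φ z • v z

/-- The `H¹(Ω)` norm `(‖u‖² + ‖∂₁u‖² + ‖∂₂u‖²)^(1/2)`, all norms in `L²(Ω)`, with `∂₁u`, `∂₂u` the
weak partial derivatives. These are unique almost everywhere, so the infimum only selects them;
it is `∞` when they do not exist. Thus `u ∈ H¹(Ω)` iff this quantity is finite. -/
def eH1Norm {E : Type*} [NormedAddCommGroup E] [NormedSpace ℝ E]
    (Ω : Set ℂ) (u : ℂ → E) : ENNReal :=
  ⨅ (v : ℂ → E) (w : ℂ → E)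
    (_ : HasWeakDerivOn Ω 1 u v) (_ : HasWeakDerivOn Ω Complex.I u w),
    (MeasureTheory.eLpNorm u 2 (MeasureTheory.volume.restrict Ω) ^ 2 +
      MeasureTheory.eLpNorm v 2 (MeasureTheory.volume.restrict Ω) ^ 2 +
      MeasureTheory.eLpNorm w 2 (MeasureTheory.volume.restrict Ω) ^ 2) ^ (1 / 2 : ℝ)

/-- `Ω` has continuous (class `C⁰`) boundary: near each boundary point, in coordinates
obtained by a translation and a rotation, `Ω` is the region strictly below the graph of a
continuous function. Every Lipschitz domain has this property. -/
def HasContinuousBoundary (Ω : Set ℂ) : Prop :=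
  ∀ p ∈ frontier Ω, ∃ (c : Circle) (r h : ℝ) (ψ : ℝ → ℝ), 0 < r ∧ 0 < h ∧ Continuous ψ ∧
    ∀ s t : ℝ, |s| < r → |t| < h →
      (p + (c : ℂ) * ((s : ℂ) + (t : ℂ) * Complex.I) ∈ Ω ↔ t < ψ s)

end

noncomputable section

open MeasureTheory Set Filter Topology Metric
open scoped ENNReal NNReal ContDiff

/-! The conjugate of the Gabor transform is `W · F`, with `W` the positive smooth weight
`gaborWeight` and `F` entire (`conj_gaborTransform`). Let `a`, `b` be the entire functions of `f`,
`g`, and `u = W (|a| - |b|)`. The task is to find a unimodular `c` with `b - c a` bounded in `H¹(Ω)`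
by `u`, with a constant independent of `b`.

Where `a ≠ 0`, the quotient `q = b / a` satisfies `|q| = 1 - u / (W |a|)`. For holomorphic `q`,
`|q'|` is at most the norm of the gradient of `|q|`, so `|q'|² ≤ C (|u|² + |∇u|²)` away from the
zeros of `a` (`exists_enorm_deriv_div_sq_le`). Hence `q` is nearly a constant `l`, and this must be
propagated over all of `Ω`.

In the interior, the area mean value inequality turns the `L²` bound on `q'` into a uniform one
(`exists_norm_deriv_div_le`). Zeros of `a` are isolated: the bound on `b - l a` is carried along a
zero-free circle around such a point, and the maximum principle fills in the disc. Connectedness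
then gives uniform control of `b - l a` on compact subsets of `Ω`, where `l = b z₀ / a z₀`
(`exists_norm_sub_le_on_compact`).

At the boundary `a` has no zeros, so `q'` is controlled in `L²` up to the boundary. Below a
continuous graph, integrating `q'` along vertical segments from a base inside `Ω` controls `q - l`
in `L²` (`lintegral_subgraph_sq_le`); no regularity of the graph beyond continuity is needed.
Compactness of the closure combines the local bounds (`exists_lintegral_holoDensity_le`).

Finally `l` is replaced by a nearest point of the unit circle: `||l| - 1| W |a|` is at most `|b - l
a| + |u|`, so `|l|` is close to `1` (`exists_circle_lintegral_holoDensity_le`). For `f = 0` the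
pointwise estimate is applied to `b / 1`. -/

/-- The integrand `‖u‖² + ‖∂₁u‖² + ‖∂₂u‖²` of the squared `H¹` norm, with classical derivatives. -/
def sobolevDensity {E : Type*} [NormedAddCommGroup E] [NormedSpace ℝ E] (u : ℂ → E) (z : ℂ) :
    ℝ≥0∞ :=
  ‖u z‖ₑ ^ 2 + ‖fderiv ℝ u z 1‖ₑ ^ 2 + ‖fderiv ℝ u z Complex.I‖ₑ ^ 2

/-! ### Weak derivatives and the `H¹` norm of smooth and of locally Lipschitz functions. -/

section WeakDerivatives

variable {E : Type*} [NormedAddCommGroup E] [NormedSpace ℝ E]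

lemma eLpNorm_two_sq {α F : Type*} [MeasurableSpace α] [NormedAddCommGroup F] (μ : Measure α)
    (u : α → F) :
    eLpNorm u 2 μ ^ 2 = ∫⁻ x, ‖u x‖ₑ ^ 2 ∂μ := by
  have h := eLpNorm_nnreal_pow_eq_lintegral (f := u) (μ := μ) (p := 2) two_ne_zero
  simpa using h

lemma lintegral_sobolevDensity [CompleteSpace E] [FiniteDimensional ℝ E] {u : ℂ → E}
    (hu : Continuous u) (μ : Measure ℂ) :
    ∫⁻ z, sobolevDensity u z ∂μ = eLpNorm u 2 μ ^ 2 + eLpNorm (fun z => fderiv ℝ u z 1) 2 μ ^ 2 +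
      eLpNorm (fun z => fderiv ℝ u z Complex.I) 2 μ ^ 2 := by
  borelize E
  have h1 : Measurable fun z => fderiv ℝ u z 1 := measurable_fderiv_apply_const ℝ u 1
  simp only [eLpNorm_two_sq, sobolevDensity]
  rw [lintegral_add_left, lintegral_add_left]
  · exact (hu.enorm.measurable.pow_const 2)
  · exact (hu.enorm.measurable.pow_const 2).add (h1.enorm.pow_const 2)

lemma eH1Norm_le_of_hasWeakDerivOn_fderiv [CompleteSpace E] [FiniteDimensional ℝ E] {Ω : Set ℂ}
    {u : ℂ → E} (hu : Continuous u)
    (h : ∀ e, HasWeakDerivOn Ω e u (fun z => fderiv ℝ u z e)) :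
    eH1Norm Ω u ≤ (∫⁻ z in Ω, sobolevDensity u z) ^ (1 / 2 : ℝ) := by
  rw [lintegral_sobolevDensity hu]
  exact iInf_le_of_le _ (iInf_le_of_le _ (iInf_le_of_le (h 1) (iInf_le_of_le (h Complex.I) le_rfl)))

lemma LocallyIntegrableOn.integrable_smul_of_tsupport_subset {Ω : Set ℂ} {v : ℂ → E}
    (hv : LocallyIntegrableOn v Ω) {φ : ℂ → ℝ} (hφ : Continuous φ) (hc : HasCompactSupport φ)
    (hs : tsupport φ ⊆ Ω) : Integrable (fun z => φ z • v z) := by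
  have h : IntegrableOn (fun z => φ z • v z) (tsupport φ) :=
    (hv.integrableOn_compact_subset hs hc).continuousOn_smul hφ.continuousOn hc
  rwa [integrableOn_iff_integrable_of_support_subset] at h
  intro z hz
  apply subset_tsupport
  intro h0
  exact hz (by simp [h0])

lemma setIntegral_smul_of_tsupport_subset {Ω : Set ℂ} {φ : ℂ → ℝ} (hs : tsupport φ ⊆ Ω)
    (v : ℂ → E) : ∫ z in Ω, φ z • v z = ∫ z, φ z • v z :=
  setIntegral_eq_integral_of_forall_compl_eq_zero fun z hz => by
    rw [image_eq_zero_of_notMem_tsupport fun h => hz (hs h), zero_smul]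

/-- The difference of the two candidates integrates to zero against every test function, so the
fundamental lemma of the calculus of variations applies. -/
lemma HasWeakDerivOn.ae_eq [FiniteDimensional ℝ E] {Ω : Set ℂ} (hΩ : IsOpen Ω) {e : ℂ}
    {u v w : ℂ → E} (hv : HasWeakDerivOn Ω e u v) (hw : HasWeakDerivOn Ω e u w) :
    v =ᵐ[volume.restrict Ω] w := by
  have : CompleteSpace E := FiniteDimensional.complete ℝ E
  have key := hΩ.ae_eq_zero_of_integral_contDiff_smul_eq_zero (μ := volume)
    (hv.2.1.sub hw.2.1) (fun φ h1 h2 h3 => by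
      have e1 := hv.2.2 φ h1 h2 h3
      have e2 := hw.2.2 φ h1 h2 h3
      rw [setIntegral_smul_of_tsupport_subset h3] at e1 e2
      simp only [Pi.sub_apply, smul_sub]
      rw [integral_sub
        (LocallyIntegrableOn.integrable_smul_of_tsupport_subset hv.2.1 h1.continuous h2 h3)
        (LocallyIntegrableOn.integrable_smul_of_tsupport_subset hw.2.1 h1.continuous h2 h3),
        sub_eq_zero]
      exact neg_injective (e1.symm.trans e2))
  rw [Filter.EventuallyEq, ae_restrict_iff' hΩ.measurableSet]
  filter_upwards [key] with z hz hzΩ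
  exact sub_eq_zero.1 (hz hzΩ)

/-- Every competitor in the infimum defining `eH1Norm` agrees almost everywhere with the classical
derivatives, so none can give a smaller value. -/
lemma le_eH1Norm_of_hasWeakDerivOn_fderiv [CompleteSpace E] [FiniteDimensional ℝ E] {Ω : Set ℂ}
    (hΩ : IsOpen Ω) {u : ℂ → E} (hu : Continuous u)
    (h : ∀ e, HasWeakDerivOn Ω e u (fun z => fderiv ℝ u z e)) :
    (∫⁻ z in Ω, sobolevDensity u z) ^ (1 / 2 : ℝ) ≤ eH1Norm Ω u := by
  rw [lintegral_sobolevDensity hu]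
  refine le_iInf fun v => le_iInf fun w => le_iInf fun hv => le_iInf fun hw => ?_
  rw [eLpNorm_congr_ae ((h 1).ae_eq hΩ hv), eLpNorm_congr_ae ((h Complex.I).ae_eq hΩ hw)]

lemma hasWeakDerivOn_fderiv_of_contDiff [FiniteDimensional ℝ E] {Ω : Set ℂ}
    {u : ℂ → E} (hu : ContDiff ℝ 1 u) (e : ℂ) :
    HasWeakDerivOn Ω e u (fun z => fderiv ℝ u z e) := by
  have hc : Continuous fun z => fderiv ℝ u z e :=
    (hu.continuous_fderiv one_ne_zero).clm_apply continuous_const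
  refine ⟨hu.continuous.locallyIntegrable.locallyIntegrableOn _,
    hc.locallyIntegrable.locallyIntegrableOn _, fun φ h1 h2 h3 => ?_⟩
  have hcφ : Continuous fun z => fderiv ℝ φ z e :=
    (h1.continuous_fderiv (by simp)).clm_apply continuous_const
  have hsφ : HasCompactSupport fun z => fderiv ℝ φ z e := h2.fderiv_apply ℝ e
  have hts : tsupport (fun z => fderiv ℝ φ z e) ⊆ Ω := (tsupport_fderiv_apply_subset ℝ e).trans h3
  rw [setIntegral_smul_of_tsupport_subset h3, setIntegral_smul_of_tsupport_subset hts,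
    integral_smul_fderiv_eq_neg_fderiv_smul_of_integrable, neg_neg]
  · exact (hcφ.smul hu.continuous).integrable_of_hasCompactSupport hsφ.smul_right
  · exact (h1.continuous.smul hc).integrable_of_hasCompactSupport h2.smul_right
  · exact (h1.continuous.smul hu.continuous).integrable_of_hasCompactSupport h2.smul_right
  · exact fun z _ => h1.differentiable (by simp) z
  · exact fun z _ => hu.differentiable one_ne_zero z

/-- A locally Lipschitz function is Lipschitz on the compact closure of `Ω` and extends from there.
This makes Rademacher's theorem and integration by parts for globally Lipschitz functions available.
-/
lemma exists_lipschitzWith_eqOn {Ω : Set ℂ} (hΩ : Bornology.IsBounded Ω) {u : ℂ → ℝ}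
    (hu : LocallyLipschitz u) : ∃ (K : ℝ≥0) (v : ℂ → ℝ), LipschitzWith K v ∧ EqOn u v Ω := by
  obtain ⟨K, hK⟩ := hu.locallyLipschitzOn.exists_lipschitzOnWith_of_compact
    hΩ.isCompact_closure
  obtain ⟨v, hv, he⟩ := hK.extend_real
  exact ⟨K, v, hv, he.mono subset_closure⟩

lemma ae_differentiableAt_of_locallyLipschitz {Ω : Set ℂ} (hΩ : IsOpen Ω)
    (hb : Bornology.IsBounded Ω) {u : ℂ → ℝ} (hu : LocallyLipschitz u) :
    ∀ᵐ z ∂(volume.restrict Ω), DifferentiableAt ℝ u z := by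
  obtain ⟨K, v, hv, he⟩ := exists_lipschitzWith_eqOn hb hu
  rw [ae_restrict_iff' hΩ.measurableSet]
  filter_upwards [hv.ae_differentiableAt] with z hz hzΩ
  exact hz.congr_of_eventuallyEq (he.eventuallyEq_of_mem (hΩ.mem_nhds hzΩ))

lemma hasWeakDerivOn_fderiv_of_locallyLipschitz {Ω : Set ℂ} (hΩ : IsOpen Ω)
    (hb : Bornology.IsBounded Ω) {u : ℂ → ℝ} (hu : LocallyLipschitz u) (e : ℂ) :
    HasWeakDerivOn Ω e u (fun z => fderiv ℝ u z e) := by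
  obtain ⟨K, v, hv, he⟩ := exists_lipschitzWith_eqOn hb hu
  have hd : ∀ᵐ z, z ∈ Ω → fderiv ℝ u z e = lineDeriv ℝ v z e := by
    filter_upwards [hv.ae_differentiableAt] with z hz hzΩ
    rw [(he.eventuallyEq_of_mem (hΩ.mem_nhds hzΩ)).fderiv_eq, hz.lineDeriv_eq_fderiv]
  have hdΩ : (fun z => fderiv ℝ u z e) =ᵐ[volume.restrict Ω] fun z => lineDeriv ℝ v z e :=
    (ae_restrict_iff' hΩ.measurableSet).2 hd
  refine ⟨hu.continuous.locallyIntegrable.locallyIntegrableOn _, ?_, fun φ h1 h2 h3 => ?_⟩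
  · have h1 : LocallyIntegrableOn (fun z => lineDeriv ℝ v z e) Ω :=
      (hv.locallyIntegrable_lineDeriv e).locallyIntegrableOn Ω
    intro z hz
    obtain ⟨t, ht, hi⟩ := h1 z hz
    refine ⟨t ∩ Ω, inter_mem ht self_mem_nhdsWithin, ?_⟩
    exact (hi.mono_set inter_subset_left).congr_fun_ae
      (ae_restrict_of_ae_restrict_of_subset inter_subset_right hdΩ.symm)
  · have hts : tsupport (fun z => fderiv ℝ φ z e) ⊆ Ω :=
      (tsupport_fderiv_apply_subset ℝ e).trans h3
    obtain ⟨D, hD⟩ := h1.lipschitzWith_of_hasCompactSupport h2 (by simp)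
    -- Integration by parts for a Lipschitz function against a compactly supported Lipschitz one, in
    -- terms of line derivatives; these equal the Fréchet derivatives almost everywhere.
    have key := hv.integral_lineDeriv_mul_eq (μ := volume) hD h2 e
    have l1 : ∫ z in Ω, φ z • fderiv ℝ u z e = ∫ z in Ω, φ z • lineDeriv ℝ v z e := by
      apply integral_congr_ae
      filter_upwards [hdΩ] with z hz
      rw [hz]
    have l2 : ∫ z in Ω, fderiv ℝ φ z e • u z = ∫ z in Ω, fderiv ℝ φ z e • v z :=
      setIntegral_congr_fun hΩ.measurableSet fun z hz => by simp only [he hz]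
    rw [l1, l2, setIntegral_smul_of_tsupport_subset h3, setIntegral_smul_of_tsupport_subset hts]
    simp only [smul_eq_mul, mul_comm (φ _), key, ← integral_neg]
    congr 1
    ext z
    rw [((h1.differentiable (by simp)) z).lineDeriv_eq_fderiv]
    simp

lemma lintegral_sobolevDensity_lt_top {Ω : Set ℂ} (hΩ : IsOpen Ω)
    (hb : Bornology.IsBounded Ω) {u : ℂ → ℝ} (hu : LocallyLipschitz u) :
    ∫⁻ z in Ω, sobolevDensity u z < ⊤ := by
  obtain ⟨K, v, hv, he⟩ := exists_lipschitzWith_eqOn hb hu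
  obtain ⟨M, hM⟩ := hb.isCompact_closure.exists_bound_of_continuousOn hu.continuous.continuousOn
  have hvol : volume Ω < ⊤ := hb.measure_lt_top
  have hd : ∀ z ∈ Ω, ∀ e : ℂ, ‖e‖ = 1 → ‖fderiv ℝ u z e‖ₑ ≤ K := by
    intro z hz e h1
    rw [(he.eventuallyEq_of_mem (hΩ.mem_nhds hz)).fderiv_eq]
    have := (fderiv ℝ v z).le_of_opNorm_le (norm_fderiv_le_of_lipschitz ℝ hv (x₀ := z)) e
    rw [h1, mul_one] at this
    rw [← enorm_norm, Real.enorm_eq_ofReal (norm_nonneg _)]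
    exact ENNReal.ofReal_le_of_le_toReal (by simpa using this)
  calc ∫⁻ z in Ω, sobolevDensity u z
      ≤ ∫⁻ z in Ω, (ENNReal.ofReal M ^ 2 + K ^ 2 + K ^ 2) := by
        refine setLIntegral_mono' hΩ.measurableSet fun z hz => ?_
        unfold sobolevDensity
        gcongr
        · rw [← enorm_norm, Real.enorm_eq_ofReal (norm_nonneg _)]
          exact ENNReal.ofReal_le_ofReal (hM z (subset_closure hz))
        · exact hd z hz 1 (by simp)
        · exact hd z hz Complex.I (by simp)
    _ = (ENNReal.ofReal M ^ 2 + K ^ 2 + K ^ 2) * volume Ω := by simp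
    _ < ⊤ := by finiteness

end WeakDerivatives

/-! ### The Gabor transform as a weight times the conjugate of an entire function. -/

/-- The weight relating the modulus of the Gabor transform to an entire function. -/
def gaborWeight (z : ℂ) : ℝ := Real.exp (-Real.pi * z.re ^ 2)

/-- The entire function `z ↦ ∫ conj (f t) φ(t) exp (2 π t z) dt`, a Bargmann transform of `f`. -/
def bargmannTransform (f : Lp ℂ 2 (volume : Measure ℝ)) (z : ℂ) : ℂ :=
  ∫ t : ℝ, (starRingEnd ℂ) (f t) *
    ((gaussianWindow t : ℂ) * Complex.exp (2 * Real.pi * t * z))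

lemma gaborWeight_pos (z : ℂ) : 0 < gaborWeight z := Real.exp_pos _

lemma contDiff_gaborWeight : ContDiff ℝ ∞ gaborWeight := by
  have h : ContDiff ℝ ∞ Complex.re := Complex.reCLM.contDiff
  exact Real.contDiff_exp.comp (contDiff_const.mul (h.pow 2))

/-- Expanding the square, `-π (t - x)² + 2π i t ω = -π x² - π t² + 2π t z`. Conjugation is what
produces `z` instead of its conjugate. -/
lemma conj_gaborTransform (f : Lp ℂ 2 (volume : Measure ℝ)) (z : ℂ) :
    (starRingEnd ℂ) (gaborTransform f z) = gaborWeight z * bargmannTransform f z := by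
  rw [gaborTransform, bargmannTransform, ← integral_conj, ← integral_const_mul]
  congr 1
  ext t
  simp only [map_mul, gaussianWindow, gaborWeight, ← Complex.exp_conj,
    Complex.conj_I, Complex.conj_ofReal, map_neg, map_ofNat,
    Complex.ofReal_mul (2 ^ (1 / 4 : ℝ)), Complex.ofReal_exp]
  have : Complex.exp ((-Real.pi * (t - z.re) ^ 2 : ℝ) : ℂ) *
      Complex.exp (-(2 : ℂ) * Real.pi * -Complex.I * t * z.im) =
      Complex.exp ((-Real.pi * z.re ^ 2 : ℝ) : ℂ) * (Complex.exp ((-Real.pi * t ^ 2 : ℝ) : ℂ) *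
        Complex.exp (2 * Real.pi * t * z)) := by
    rw [← Complex.exp_add, ← Complex.exp_add, ← Complex.exp_add]
    congr 1
    have hz : z = z.re + z.im * Complex.I := (Complex.re_add_im z).symm
    push_cast
    linear_combination -2 * Real.pi * t * hz
  linear_combination (starRingEnd ℂ) (f t) * ((2 : ℝ) ^ (1 / 4 : ℝ) : ℝ) * this

/-- The linear factor is absorbed into the exponential by raising `S` to `S + 1`; half of the
Gaussian then dominates the linear exponent by completing a square. -/
lemma two_pi_mul_abs_mul_exp_le (S t : ℝ) :
    2 * Real.pi * |t| * Real.exp (-Real.pi * t ^ 2 + 2 * Real.pi * S * |t|) ≤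
      Real.exp (2 * Real.pi * (S + 1) ^ 2) * Real.exp (-(Real.pi / 2) * t ^ 2) := by
  have h1 : 2 * Real.pi * |t| ≤ Real.exp (2 * Real.pi * |t|) := by
    linarith [Real.add_one_le_exp (2 * Real.pi * |t|)]
  calc _ ≤ Real.exp (2 * Real.pi * |t|) *
        Real.exp (-Real.pi * t ^ 2 + 2 * Real.pi * S * |t|) := by gcongr
    _ ≤ _ := by
      rw [← Real.exp_add, ← Real.exp_add, Real.exp_le_exp]
      have h2 : 0 ≤ Real.pi / 2 * (|t| - 2 * (S + 1)) ^ 2 := by positivity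
      rw [← sq_abs t]
      linarith

lemma exp_quadratic_le (S t : ℝ) :
    Real.exp (-Real.pi * t ^ 2 + 2 * Real.pi * S * |t|) ≤
      Real.exp (2 * Real.pi * S ^ 2) * Real.exp (-(Real.pi / 2) * t ^ 2) := by
  rw [← Real.exp_add, Real.exp_le_exp]
  have h2 : 0 ≤ Real.pi / 2 * (|t| - 2 * S) ^ 2 := by positivity
  rw [← sq_abs t]
  linarith

lemma norm_gaussianWindow_mul_exp_le {R t : ℝ} {z : ℂ} (hz : ‖z‖ ≤ R) :
    ‖(gaussianWindow t : ℂ) * Complex.exp (2 * Real.pi * t * z)‖ ≤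
      (2 : ℝ) ^ (1 / 4 : ℝ) * Real.exp (-Real.pi * t ^ 2 + 2 * Real.pi * R * |t|) := by
  rw [norm_mul, Complex.norm_real, Complex.norm_exp, gaussianWindow, Real.norm_eq_abs,
    abs_of_nonneg (by positivity), mul_assoc, ← Real.exp_add]
  gcongr
  have h : (2 * (Real.pi : ℂ) * t * z).re = 2 * Real.pi * (t * z.re) := by
    simp [mul_assoc]
  rw [h, mul_assoc (2 * Real.pi), mul_comm R]
  refine mul_le_mul_of_nonneg_left ?_ (by positivity)
  calc t * z.re ≤ |t * z.re| := le_abs_self _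
    _ = |t| * |z.re| := abs_mul _ _
    _ ≤ |t| * R := by
      gcongr
      exact (Complex.abs_re_le_norm z).trans hz

lemma memLp_two_exp_neg_mul_sq {b : ℝ} (hb : 0 < b) :
    MemLp (fun t : ℝ => Real.exp (-b * t ^ 2)) 2 := by
  rw [memLp_two_iff_integrable_sq (by fun_prop)]
  refine (integrable_exp_neg_mul_sq (b := 2 * b) (by positivity)).congr ?_
  filter_upwards with t
  rw [sq (Real.exp _), ← Real.exp_add]
  ring_nf

/-- Differentiation under the integral sign. On the unit ball around `z₀` the differentiated
integrand is dominated by `|f|` times a Gaussian, a product of two `L²` functions. -/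
lemma differentiable_bargmannTransform (f : Lp ℂ 2 (volume : Measure ℝ)) :
    Differentiable ℂ (bargmannTransform f) := by
  intro z₀
  have hf : MemLp (fun t => ‖f t‖) 2 := (Lp.memLp f).norm
  have hint : Integrable fun t : ℝ => ‖f t‖ * Real.exp (-(Real.pi / 2) * t ^ 2) :=
    hf.integrable_mul (memLp_two_exp_neg_mul_sq (by positivity))
  have hfm : AEStronglyMeasurable (fun t => (starRingEnd ℂ) (f t)) volume :=
    Complex.continuous_conj.comp_aestronglyMeasurable (Lp.aestronglyMeasurable f)
  have hgm : ∀ z : ℂ, Continuous fun t : ℝ =>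
      (gaussianWindow t : ℂ) * Complex.exp (2 * Real.pi * t * z) := by
    intro z
    unfold gaussianWindow
    fun_prop
  set R := ‖z₀‖ + 1 with hR
  refine (hasDerivAt_integral_of_dominated_loc_of_deriv_le (μ := volume)
    (F := fun (z : ℂ) (t : ℝ) => (starRingEnd ℂ) (f t) *
      ((gaussianWindow t : ℂ) * Complex.exp (2 * Real.pi * t * z)))
    (F' := fun (z : ℂ) (t : ℝ) => (starRingEnd ℂ) (f t) *
      ((gaussianWindow t : ℂ) * Complex.exp (2 * Real.pi * t * z)) * (2 * Real.pi * t))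
    (bound := fun t => (2 : ℝ) ^ (1 / 4 : ℝ) * Real.exp (2 * Real.pi * (R + 1) ^ 2) *
      (‖f t‖ * Real.exp (-(Real.pi / 2) * t ^ 2)))
    (ball_mem_nhds z₀ one_pos) ?_ ?_ ?_ ?_ ?_ ?_).2.differentiableAt
  · exact Eventually.of_forall fun z => hfm.mul (hgm z).aestronglyMeasurable
  · refine (hint.const_mul ((2 : ℝ) ^ (1 / 4 : ℝ) * Real.exp (2 * Real.pi * R ^ 2))).mono'
      (hfm.mul (hgm z₀).aestronglyMeasurable) (Eventually.of_forall fun t => ?_)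
    rw [norm_mul, RCLike.norm_conj]
    calc _ ≤ ‖f t‖ * ((2 : ℝ) ^ (1 / 4 : ℝ) * (Real.exp (2 * Real.pi * R ^ 2) *
          Real.exp (-(Real.pi / 2) * t ^ 2))) := by
          gcongr
          refine (norm_gaussianWindow_mul_exp_le (R := R) (by simp [hR])).trans ?_
          gcongr
          exact exp_quadratic_le R t
      _ = _ := by ring
  · exact (hfm.mul (hgm z₀).aestronglyMeasurable).mul (by fun_prop)
  · refine Eventually.of_forall fun t z hz => ?_
    have hzR : ‖z‖ ≤ R := by
      have h1 : ‖z - z₀‖ < 1 := by simpa [dist_eq_norm] using hz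
      have h2 := norm_add_le (z - z₀) z₀
      rw [sub_add_cancel] at h2
      linarith
    have h3 : ‖(2 * Real.pi * t : ℂ)‖ = 2 * Real.pi * |t| := by
      simp [abs_of_pos Real.pi_pos]
    rw [norm_mul, norm_mul, RCLike.norm_conj, h3]
    calc _ ≤ ‖f t‖ * ((2 : ℝ) ^ (1 / 4 : ℝ) *
            Real.exp (-Real.pi * t ^ 2 + 2 * Real.pi * R * |t|)) * (2 * Real.pi * |t|) := by
          gcongr
          exact norm_gaussianWindow_mul_exp_le hzR
      _ = ‖f t‖ * (2 : ℝ) ^ (1 / 4 : ℝ) * (2 * Real.pi * |t| *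
            Real.exp (-Real.pi * t ^ 2 + 2 * Real.pi * R * |t|)) := by ring
      _ ≤ ‖f t‖ * (2 : ℝ) ^ (1 / 4 : ℝ) * (Real.exp (2 * Real.pi * (R + 1) ^ 2) *
            Real.exp (-(Real.pi / 2) * t ^ 2)) := by
          exact mul_le_mul_of_nonneg_left (two_pi_mul_abs_mul_exp_le R t) (by positivity)
      _ = _ := by ring
  · exact hint.const_mul _
  · refine Eventually.of_forall fun t z _ => ?_
    have h : HasDerivAt (fun z : ℂ => 2 * Real.pi * t * z) (2 * Real.pi * t : ℂ) z := by
      simpa using (hasDerivAt_id z).const_mul (2 * Real.pi * t : ℂ)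
    have := (h.cexp.const_mul (gaussianWindow t : ℂ)).const_mul ((starRingEnd ℂ) (f t))
    exact this.congr_deriv (by ring)

lemma norm_gaborTransform (f : Lp ℂ 2 (volume : Measure ℝ)) (z : ℂ) :
    ‖gaborTransform f z‖ = gaborWeight z * ‖bargmannTransform f z‖ := by
  rw [← RCLike.norm_conj, conj_gaborTransform, norm_mul, Complex.norm_real, Real.norm_eq_abs,
    abs_of_pos (gaborWeight_pos z)]

/-! ### Pointwise control of the derivative of `b / a` by the difference of moduli. -/

/-- A nonzero complex derivative can rotate a unit direction `e` into any phase. With `e` chosen so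
that `q` moves radially outwards, `|q|` grows along `e` at rate exactly `|q'|`. -/
lemma norm_deriv_le_norm_fderiv_norm {q : ℂ → ℂ} {q' z : ℂ} (hq : HasDerivAt q q' z)
    (hd : DifferentiableAt ℝ (fun w => ‖q w‖) z) : ‖q'‖ ≤ ‖fderiv ℝ (fun w => ‖q w‖) z‖ := by
  rcases eq_or_ne q' 0 with h0 | h0
  · simp [h0]
  obtain ⟨σ, hσ1, hσ⟩ : ∃ σ : ℂ, ‖σ‖ = 1 ∧ q z = ‖q z‖ * σ := by
    rcases eq_or_ne (q z) 0 with h | h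
    · exact ⟨1, by simp, by simp [h]⟩
    · have : (‖q z‖ : ℂ) ≠ 0 := by simpa using h
      exact ⟨q z / ‖q z‖, by simp [h], by field_simp⟩
  have hn : ‖q'‖ ≠ 0 := by simpa using h0
  set e : ℂ := ‖q'‖ * σ / q' with he
  have he1 : ‖e‖ = 1 := by simp [he, hσ1, hn]
  have hq'e : e * q' = ‖q'‖ * σ := by rw [he]; field_simp
  have hline : HasDerivAt (fun t : ℝ => z + (t : ℂ) * e) e 0 := by
    simpa using ((hasDerivAt_id (0 : ℝ)).ofReal_comp.mul_const e).const_add z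
  have h1 : HasDerivAt (fun t : ℝ => q (z + (t : ℂ) * e)) (e * q') 0 := by
    have := HasDerivAt.scomp (h := fun t : ℝ => z + (t : ℂ) * e) (0 : ℝ)
      (by simpa using hq) hline
    simpa [Function.comp_def] using this
  have h2 : HasDerivAt (fun t : ℝ => ‖q (z + (t : ℂ) * e)‖)
      (fderiv ℝ (fun w => ‖q w‖) z e) 0 := by
    have := HasFDerivAt.comp_hasDerivAt (f := fun t : ℝ => z + (t : ℂ) * e) (0 : ℝ)
      (l := fun w => ‖q w‖) (by simpa using hd.hasFDerivAt) hline
    simpa [Function.comp_def] using this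
  -- Only the right derivative is available: if `q z = 0`, the first-order model `|q z| + t |q'|` is
  -- negative for `t < 0` and is no longer a modulus.
  have h3 : HasDerivWithinAt (fun t : ℝ => ‖q (z + (t : ℂ) * e)‖) ‖q'‖ (Ici 0) 0 := by
    rw [hasDerivWithinAt_iff_isLittleO]
    refine (Asymptotics.IsBigO.of_bound 1 ?_).trans_isLittleO
      ((hasDerivAt_iff_isLittleO.1 h1).mono nhdsWithin_le_nhds)
    filter_upwards [self_mem_nhdsWithin] with t ht
    have ht0 : (0 : ℝ) ≤ t := ht
    have h5 : ‖q z + t * (e * q')‖ = ‖q z‖ + t * ‖q'‖ := by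
      have h6 : q z + t * (e * q') = ((‖q z‖ + t * ‖q'‖ : ℝ) : ℂ) * σ := by
        rw [hq'e]
        push_cast
        linear_combination hσ
      rw [h6, norm_mul, hσ1, mul_one, Complex.norm_real, Real.norm_eq_abs,
        abs_of_nonneg (by positivity)]
    have h7 := abs_norm_sub_norm_le (q (z + t * e)) (q z + t * (e * q'))
    rw [h5] at h7
    simpa [sub_sub, Real.norm_eq_abs] using h7
  have h4 := (uniqueDiffWithinAt_Ici (0 : ℝ)).eq_deriv _ h2.hasDerivWithinAt h3
  calc ‖q'‖ = fderiv ℝ (fun w => ‖q w‖) z e := h4.symm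
    _ ≤ ‖fderiv ℝ (fun w => ‖q w‖) z e‖ := Real.le_norm_self _
    _ ≤ ‖fderiv ℝ (fun w => ‖q w‖) z‖ * ‖e‖ := (fderiv ℝ _ z).le_opNorm e
    _ = _ := by rw [he1, mul_one]

lemma opNorm_le_apply_one_add_apply_I (L : ℂ →L[ℝ] ℝ) : ‖L‖ ≤ ‖L 1‖ + ‖L Complex.I‖ := by
  refine L.opNorm_le_bound (by positivity) fun z => ?_
  have h : L z = z.re * L 1 + z.im * L Complex.I := by
    conv_lhs => rw [show z = z.re • (1 : ℂ) + z.im • Complex.I by simp]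
    rw [map_add, map_smul, map_smul, smul_eq_mul, smul_eq_mul]
  rw [h]
  calc _ ≤ ‖z.re * L 1‖ + ‖z.im * L Complex.I‖ := norm_add_le _ _
    _ = |z.re| * ‖L 1‖ + |z.im| * ‖L Complex.I‖ := by simp [norm_mul]
    _ ≤ ‖z‖ * ‖L 1‖ + ‖z‖ * ‖L Complex.I‖ := by
      gcongr
      · exact Complex.abs_re_le_norm z
      · exact Complex.abs_im_le_norm z
    _ = _ := by ring

lemma enorm_sq_eq_ofReal {F : Type*} [NormedAddCommGroup F] (x : F) :
    ‖x‖ₑ ^ 2 = ENNReal.ofReal (‖x‖ ^ 2) := by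
  rw [← ofReal_norm, ENNReal.ofReal_pow (norm_nonneg _)]

lemma sobolevDensity_eq_ofReal {E : Type*} [NormedAddCommGroup E] [NormedSpace ℝ E] (u : ℂ → E)
    (z : ℂ) : sobolevDensity u z = ENNReal.ofReal
      (‖u z‖ ^ 2 + ‖fderiv ℝ u z 1‖ ^ 2 + ‖fderiv ℝ u z Complex.I‖ ^ 2) := by
  rw [sobolevDensity, ENNReal.ofReal_add (by positivity) (by positivity),
    ENNReal.ofReal_add (by positivity) (by positivity)]
  simp only [enorm_sq_eq_ofReal]

/-- The weighted difference of moduli `W (α |a| - |b|)`. -/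
def moduliDiff (α : ℝ) (a b : ℂ → ℂ) (z : ℂ) : ℝ := gaborWeight z * (α * ‖a z‖ - ‖b z‖)

lemma Differentiable.locallyLipschitz_gaborWeight_mul_norm {a : ℂ → ℂ}
    (ha : Differentiable ℂ a) : LocallyLipschitz fun z => gaborWeight z * ‖a z‖ := by
  have h : ContDiff ℝ 1 fun z => (gaborWeight z : ℂ) * a z :=
    (Complex.ofRealCLM.contDiff.comp (contDiff_gaborWeight.of_le (by simp))).mul
      (ha.contDiff.restrict_scalars ℝ)
  have h2 := lipschitzWith_one_norm.locallyLipschitz.comp h.locallyLipschitz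
  have h3 : (fun z => gaborWeight z * ‖a z‖) = (fun w : ℂ => ‖w‖) ∘ fun z => (gaborWeight z : ℂ) * a z := by
    ext z
    simp [abs_of_pos (gaborWeight_pos z)]
  rwa [h3]

lemma locallyLipschitz_moduliDiff (α : ℝ) {a b : ℂ → ℂ} (ha : Differentiable ℂ a)
    (hb : Differentiable ℂ b) : LocallyLipschitz (moduliDiff α a b) := by
  have h1 := ha.locallyLipschitz_gaborWeight_mul_norm
  have h2 := hb.locallyLipschitz_gaborWeight_mul_norm
  have h3 : LocallyLipschitz fun p : ℝ × ℝ => α * p.1 - p.2 := by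
    have : ContDiff ℝ 1 fun p : ℝ × ℝ => α * p.1 - p.2 := by fun_prop
    exact this.locallyLipschitz
  have h4 : moduliDiff α a b = (fun p : ℝ × ℝ => α * p.1 - p.2) ∘
      fun z => (gaborWeight z * ‖a z‖, gaborWeight z * ‖b z‖) := by
    ext z
    simp [moduliDiff]
    ring
  rw [h4]
  exact h3.comp (h1.prodMk h2)

/-- Pointwise control of the derivative of the quotient by the difference of moduli. -/
lemma exists_enorm_deriv_div_sq_le (α : ℝ) {a : ℂ → ℂ} (ha : Differentiable ℂ a) {K : Set ℂ}
    (hK : IsCompact K) (haK : ∀ z ∈ K, a z ≠ 0) :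
    ∃ C : ℝ≥0, ∀ b : ℂ → ℂ, Differentiable ℂ b → ∀ z ∈ K,
      DifferentiableAt ℝ (moduliDiff α a b) z →
      ‖deriv (fun w => b w / a w) z‖ₑ ^ 2 ≤ C * sobolevDensity (moduliDiff α a b) z := by
  set m : ℂ → ℝ := fun z => (gaborWeight z * ‖a z‖)⁻¹ with hm
  have hopen : IsOpen {z | a z ≠ 0} := isOpen_ne_fun ha.continuous continuous_const
  have hmC : ContDiffOn ℝ 1 m {z | a z ≠ 0} := by
    intro z hz
    have h1 : ContDiffAt ℝ 1 a z := (ha.contDiff.restrict_scalars ℝ).contDiffAt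
    refine ContDiffAt.contDiffWithinAt (ContDiffAt.inv
      ((contDiff_gaborWeight.of_le (by simp)).contDiffAt.mul (h1.norm ℝ hz)) ?_)
    exact mul_ne_zero (gaborWeight_pos z).ne' (norm_ne_zero_iff.2 hz)
  obtain ⟨M₁, hM₁⟩ := hK.exists_bound_of_continuousOn (hmC.continuousOn.mono haK)
  obtain ⟨M₂, hM₂⟩ := hK.exists_bound_of_continuousOn
    ((hmC.continuousOn_fderiv_of_isOpen hopen le_rfl).mono haK)
  set M : ℝ := max 0 (max M₁ M₂) with hMdef
  have hM0 : 0 ≤ M := le_max_left _ _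
  -- The factor `3` comes from `(x + y + w)² ≤ 3 (x² + y² + w²)`, and `M` bounds `m = 1 / (W |a|)`
  -- and its gradient on `K`, independently of `b`.
  refine ⟨(3 * M ^ 2).toNNReal, fun b hb z hz hd => ?_⟩
  set u := moduliDiff α a b with hu
  have haz := haK z hz
  have hq : HasDerivAt (fun w => b w / a w) (deriv (fun w => b w / a w) z) z :=
    ((hb z).div (ha z) haz).hasDerivAt
  -- The crucial identity: the modulus of the quotient is an affine function of `u`, with
  -- coefficients that do not involve `b`.
  have hev : (fun w => ‖b w / a w‖) =ᶠ[𝓝 z] fun w => α - u w * m w := by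
    filter_upwards [hopen.mem_nhds haz] with w hw
    have h1 := (gaborWeight_pos w).ne'
    have h2 : ‖a w‖ ≠ 0 := norm_ne_zero_iff.2 hw
    simp only [hu, hm, moduliDiff, norm_div]
    field_simp
    ring
  have hmd : DifferentiableAt ℝ m z :=
    (hmC.contDiffAt (hopen.mem_nhds haz)).differentiableAt one_ne_zero
  have hder : HasFDerivAt (fun w => ‖b w / a w‖) (-(u z • fderiv ℝ m z + m z • fderiv ℝ u z)) z :=
    ((hd.hasFDerivAt.mul hmd.hasFDerivAt).const_sub α).congr_of_eventuallyEq hev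
  have hle := norm_deriv_le_norm_fderiv_norm hq hder.differentiableAt
  rw [hder.fderiv, norm_neg] at hle
  have hb1 : ‖m z‖ ≤ M := (hM₁ z hz).trans ((le_max_left _ _).trans (le_max_right _ _))
  have hb2 : ‖fderiv ℝ m z‖ ≤ M := (hM₂ z hz).trans ((le_max_right _ _).trans (le_max_right _ _))
  have hle2 : ‖deriv (fun w => b w / a w) z‖ ≤
      M * (‖u z‖ + ‖fderiv ℝ u z 1‖ + ‖fderiv ℝ u z Complex.I‖) := by
    calc _ ≤ ‖u z • fderiv ℝ m z‖ + ‖m z • fderiv ℝ u z‖ := hle.trans (norm_add_le _ _)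
      _ = ‖u z‖ * ‖fderiv ℝ m z‖ + ‖m z‖ * ‖fderiv ℝ u z‖ := by rw [norm_smul, norm_smul]
      _ ≤ ‖u z‖ * M + M * (‖fderiv ℝ u z 1‖ + ‖fderiv ℝ u z Complex.I‖) := by
        gcongr
        exact opNorm_le_apply_one_add_apply_I _
      _ = _ := by ring
  rw [enorm_sq_eq_ofReal, sobolevDensity_eq_ofReal, ← ENNReal.ofReal_coe_nnreal,
    Real.coe_toNNReal _ (by positivity), ← ENNReal.ofReal_mul (by positivity)]
  apply ENNReal.ofReal_le_ofReal
  calc _ ≤ (M * (‖u z‖ + ‖fderiv ℝ u z 1‖ + ‖fderiv ℝ u z Complex.I‖)) ^ 2 := by gcongr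
    _ = M ^ 2 * (‖u z‖ + ‖fderiv ℝ u z 1‖ + ‖fderiv ℝ u z Complex.I‖) ^ 2 := by ring
    _ ≤ M ^ 2 * (3 * (‖u z‖ ^ 2 + ‖fderiv ℝ u z 1‖ ^ 2 + ‖fderiv ℝ u z Complex.I‖ ^ 2)) := by
      gcongr
      nlinarith [sq_nonneg (‖u z‖ - ‖fderiv ℝ u z 1‖),
        sq_nonneg (‖u z‖ - ‖fderiv ℝ u z Complex.I‖),
        sq_nonneg (‖fderiv ℝ u z 1‖ - ‖fderiv ℝ u z Complex.I‖)]
    _ = _ := by ring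

/-! ### Mean value inequalities for holomorphic functions. -/

lemma enorm_mul_two_pi_le_lintegral_circleMap {k : ℂ → ℂ} {w : ℂ} {ρ : ℝ} (hρ : 0 < ρ)
    (hk : DiffContOnCl ℂ k (ball w ρ)) :
    ENNReal.ofReal (2 * Real.pi) * ‖k w‖ₑ ≤
      ∫⁻ θ in Ioo (-Real.pi) Real.pi, ‖k (circleMap w ρ θ)‖ₑ := by
  have h1 : Real.circleAverage k w ρ = k w := by
    apply DiffContOnCl.circleAverage
    rwa [abs_of_pos hρ]
  have h2 : (2 * Real.pi : ℝ) • k w = ∫ θ in Ioo (-Real.pi) Real.pi, k (circleMap w ρ θ) := by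
    have h3 := (((periodic_circleMap w ρ).comp k).intervalIntegral_add_eq 0 (-Real.pi))
    rw [← h1, Real.circleAverage, smul_smul, mul_inv_cancel₀ (by positivity), one_smul]
    rw [← integral_Ioc_eq_integral_Ioo,
      ← intervalIntegral.integral_of_le (by linarith [Real.pi_pos])]
    rw [zero_add, show -Real.pi + 2 * Real.pi = Real.pi by ring] at h3
    exact h3
  have h4 := enorm_integral_le_lintegral_enorm (μ := volume.restrict (Ioo (-Real.pi) Real.pi))
    (fun θ => k (circleMap w ρ θ))
  rw [← h2, enorm_smul, Real.enorm_eq_ofReal (by positivity)] at h4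
  exact h4

/-- The area mean value inequality. -/
lemma enorm_mul_area_le_lintegral_ball {k : ℂ → ℂ} (hm : Measurable k) {w : ℂ} {r : ℝ}
    (hr : 0 < r) (hk : DifferentiableOn ℂ k (ball w r)) :
    ENNReal.ofReal (Real.pi * r ^ 2) * ‖k w‖ₑ ≤ ∫⁻ z in ball w r, ‖k z‖ₑ := by
  have e1 : ∫⁻ z in ball w r, ‖k z‖ₑ = ∫⁻ z, (ball (0 : ℂ) r).indicator (fun z => ‖k (w + z)‖ₑ) z := by
    rw [← lintegral_indicator measurableSet_ball, ← lintegral_add_left_eq_self _ w]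
    congr 1
    ext z
    simp [indicator, dist_eq_norm]
  rw [e1, ← Complex.lintegral_comp_polarCoord_symm, polarCoord_target,
    Measure.volume_eq_prod, ← Measure.prod_restrict, lintegral_prod]
  · calc ENNReal.ofReal (Real.pi * r ^ 2) * ‖k w‖ₑ
        = ∫⁻ ρ in Ioo 0 r, ENNReal.ofReal ρ * (ENNReal.ofReal (2 * Real.pi) * ‖k w‖ₑ) := by
          rw [lintegral_mul_const _ (by fun_prop), ← mul_assoc]
          congr 1
          rw [← ofReal_integral_eq_lintegral_ofReal, ← integral_Ioc_eq_integral_Ioo,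
            ← intervalIntegral.integral_of_le hr.le, integral_id,
            ← ENNReal.ofReal_mul (by rw [zero_pow two_ne_zero, sub_zero]; positivity)]
          · congr 1; ring
          · exact (continuous_id.integrableOn_Icc).mono_set Ioo_subset_Icc_self
          · exact (ae_restrict_iff' measurableSet_Ioo).2 (Eventually.of_forall fun x hx => hx.1.le)
      _ ≤ ∫⁻ ρ in Ioo 0 r, ∫⁻ θ in Ioo (-Real.pi) Real.pi, ENNReal.ofReal ρ •
            (ball (0 : ℂ) r).indicator (fun z => ‖k (w + z)‖ₑ)
              (Complex.polarCoord.symm (ρ, θ)) := by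
          -- In polar coordinates, the circular mean value inequality is applied at each radius `ρ <
          -- r`.
          refine setLIntegral_mono' measurableSet_Ioo fun ρ hρ => ?_
          have hs : closedBall w ρ ⊆ ball w r := closedBall_subset_ball hρ.2
          have := enorm_mul_two_pi_le_lintegral_circleMap hρ.1 (hk.diffContOnCl_ball hs)
          simp only [smul_eq_mul]
          rw [lintegral_const_mul' _ _ ENNReal.ofReal_ne_top]
          refine mul_le_mul_right (this.trans_eq ?_) _
          congr 1
          ext θ
          rw [indicator_of_mem]
          · simp [circleMap, Complex.exp_mul_I]
          · simp [abs_of_pos hρ.1, hρ.2]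
      _ ≤ _ := lintegral_mono_set fun x hx => hx.1
  · apply Measurable.aemeasurable
    have hms : Measurable fun p : ℝ × ℝ => Complex.polarCoord.symm p := by
      simp only [Complex.polarCoord_symm_apply]
      fun_prop
    have hmi : Measurable ((ball (0 : ℂ) r).indicator (fun z => ‖k (w + z)‖ₑ)) :=
      (hm.comp (measurable_const_add w)).enorm.indicator measurableSet_ball
    exact (ENNReal.measurable_ofReal.comp measurable_fst).smul (hmi.comp hms)

/-! ### Interior estimates and propagation across the zeros of `a`. -/

/-- The `H¹(Ω)` norm of the weighted difference of moduli, as a real number. -/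
def moduliDist (Ω : Set ℂ) (α : ℝ) (a b : ℂ → ℂ) : ℝ :=
  √(∫⁻ z in Ω, sobolevDensity (moduliDiff α a b) z).toReal

lemma moduliDist_nonneg (Ω : Set ℂ) (α : ℝ) (a b : ℂ → ℂ) : 0 ≤ moduliDist Ω α a b :=
  Real.sqrt_nonneg _

section Interior

variable {Ω : Set ℂ} {α : ℝ} {a : ℂ → ℂ}

lemma ofReal_moduliDist_sq (hΩ : IsOpen Ω) (hbd : Bornology.IsBounded Ω)
    (ha : Differentiable ℂ a) {b : ℂ → ℂ} (hb : Differentiable ℂ b) :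
    ENNReal.ofReal (moduliDist Ω α a b ^ 2) = ∫⁻ z in Ω, sobolevDensity (moduliDiff α a b) z := by
  rw [moduliDist, Real.sq_sqrt ENNReal.toReal_nonneg, ENNReal.ofReal_toReal]
  exact (lintegral_sobolevDensity_lt_top hΩ hbd (locallyLipschitz_moduliDiff α ha hb)).ne

/-- The pointwise estimate needs `u` differentiable, which Rademacher's theorem provides almost
everywhere. Since `K` may reach the boundary of `Ω`, this serves both the interior and the boundary.
-/
lemma exists_setLIntegral_deriv_div_sq_le (α : ℝ) (hΩ : IsOpen Ω) (hbd : Bornology.IsBounded Ω)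
    (ha : Differentiable ℂ a) {K : Set ℂ} (hK : IsCompact K) (haK : ∀ z ∈ K, a z ≠ 0) :
    ∃ C : ℝ≥0, ∀ b : ℂ → ℂ, Differentiable ℂ b → ∀ T ⊆ K ∩ Ω, MeasurableSet T →
      ∫⁻ z in T, ‖deriv (fun w => b w / a w) z‖ₑ ^ 2 ≤
        C * ∫⁻ z in Ω, sobolevDensity (moduliDiff α a b) z := by
  obtain ⟨C, hC⟩ := exists_enorm_deriv_div_sq_le α ha hK haK
  refine ⟨C, fun b hb T hT hTm => ?_⟩
  rw [← lintegral_const_mul' _ _ ENNReal.coe_ne_top]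
  refine le_trans ?_ (lintegral_mono_set (hT.trans inter_subset_right))
  refine lintegral_mono_ae ?_
  have h1 := ae_restrict_of_ae_restrict_of_subset (hT.trans inter_subset_right)
    (ae_differentiableAt_of_locallyLipschitz hΩ hbd (locallyLipschitz_moduliDiff α ha hb))
  filter_upwards [h1, ae_restrict_mem hTm] with z hz hzT
  exact hC b hb z (hT hzT).1 hz

/-- The square of `q'` is holomorphic on discs of a fixed radius `δ` around points of `K`, so its
value at the centre is bounded by its area mean, that is, by the `L²` norm of `q'`. -/
lemma exists_norm_deriv_div_le (α : ℝ) (hΩ : IsOpen Ω) (hbd : Bornology.IsBounded Ω)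
    (ha : Differentiable ℂ a) {K : Set ℂ} (hK : IsCompact K) (hKΩ : K ⊆ Ω)
    (haK : ∀ z ∈ K, a z ≠ 0) :
    ∃ C : ℝ, ∀ b : ℂ → ℂ, Differentiable ℂ b → ∀ z ∈ K,
      ‖deriv (fun w => b w / a w) z‖ ≤ C * moduliDist Ω α a b := by
  have hopen : IsOpen {z | a z ≠ 0} := isOpen_ne_fun ha.continuous continuous_const
  obtain ⟨δ, hδ, hsub⟩ := hK.exists_cthickening_subset_open (hΩ.inter hopen)
    (fun z hz => ⟨hKΩ hz, haK z hz⟩)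
  obtain ⟨C, hC⟩ := exists_setLIntegral_deriv_div_sq_le α hΩ hbd ha (hK.cthickening (r := δ))
    (fun z hz => (hsub hz).2)
  refine ⟨√(C / (Real.pi * δ ^ 2)), fun b hb w hw => ?_⟩
  set q' := deriv (fun w => b w / a w)
  have hball : ball w δ ⊆ cthickening δ K :=
    ball_subset_closedBall.trans (closedBall_subset_cthickening hw δ)
  have hd : DifferentiableOn ℂ q' (ball w δ) :=
    DifferentiableOn.deriv (fun z hz => ((hb z).div (ha z)
      (hsub (hball hz)).2).differentiableWithinAt) isOpen_ball
  have h1 := enorm_mul_area_le_lintegral_ball (k := fun z => q' z ^ 2)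
    ((measurable_deriv _).pow_const 2) hδ (hd.pow 2)
  have h2 := hC b hb (ball w δ) (fun z hz => ⟨hball hz, (hsub (hball hz)).1⟩) measurableSet_ball
  simp only [enorm_pow] at h1
  have h3 := h1.trans h2
  rw [← ofReal_moduliDist_sq hΩ hbd ha hb, enorm_sq_eq_ofReal, ← ENNReal.ofReal_coe_nnreal,
    ← ENNReal.ofReal_mul (by positivity), ← ENNReal.ofReal_mul (by positivity),
    ENNReal.ofReal_le_ofReal_iff (by positivity)] at h3
  refine (sq_le_sq₀ (norm_nonneg _)
    (mul_nonneg (Real.sqrt_nonneg _) (moduliDist_nonneg _ _ _ _))).1 ?_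
  rw [mul_pow, Real.sq_sqrt (by positivity), div_mul_eq_mul_div, le_div_iff₀ (by positivity)]
  linarith

lemma exists_norm_sub_le_on_closedBall_center (hΩ : IsOpen Ω) (hbd : Bornology.IsBounded Ω)
    (ha : Differentiable ℂ a) {z₀ : ℂ} (hz₀ : z₀ ∈ Ω) (haz₀ : a z₀ ≠ 0) :
    ∃ r > 0, ∃ C : ℝ, ∀ b : ℂ → ℂ, Differentiable ℂ b → ∀ w ∈ ball z₀ r,
      ‖b w - b z₀ / a z₀ * a w‖ ≤ C * moduliDist Ω α a b := by
  have hopen : IsOpen {z | a z ≠ 0} := isOpen_ne_fun ha.continuous continuous_const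
  obtain ⟨r, hr, hsub⟩ := nhds_basis_closedBall.mem_iff.1
    ((hΩ.inter hopen).mem_nhds ⟨hz₀, haz₀⟩)
  obtain ⟨C, hC⟩ := exists_norm_deriv_div_le α hΩ hbd ha (isCompact_closedBall z₀ r)
    (fun z hz => (hsub hz).1) (fun z hz => (hsub hz).2)
  obtain ⟨A, hA⟩ := (isCompact_closedBall z₀ r).exists_bound_of_continuousOn
    ha.continuous.continuousOn
  have hA0 : 0 ≤ A := (norm_nonneg _).trans (hA z₀ (mem_closedBall_self hr.le))
  refine ⟨r, hr, A * (C * r), fun b hb w hw => ?_⟩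
  have hw' := ball_subset_closedBall hw
  have h0 : 0 ≤ C * moduliDist Ω α a b :=
    (norm_nonneg _).trans (hC b hb z₀ (mem_closedBall_self hr.le))
  have h1 := Convex.norm_image_sub_le_of_norm_deriv_le (𝕜 := ℂ)
    (fun z hz => (hb z).div (ha z) (hsub hz).2) (hC b hb) (convex_closedBall z₀ r)
    (mem_closedBall_self hr.le) hw'
  have h2 : b w - b z₀ / a z₀ * a w = a w * (b w / a w - b z₀ / a z₀) := by
    have : a w ≠ 0 := (hsub hw').2
    field_simp
  rw [h2, norm_mul]
  calc _ ≤ A * (C * moduliDist Ω α a b * r) := by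
        gcongr
        · exact hA w hw'
        · refine h1.trans ?_
          gcongr
          simpa [dist_eq_norm] using hw'
    _ = _ := by ring

/-- Integration along a circle and the maximum principle spread a bound from one point of the
circle to the whole disc. -/
lemma exists_norm_sub_le_on_closedBall_of_mem_sphere (hΩ : IsOpen Ω)
    (hbd : Bornology.IsBounded Ω) (ha : Differentiable ℂ a) (l : (ℂ → ℂ) → ℂ) {z p : ℂ}
    (hpz : p ≠ z) (hsub : sphere z (dist p z) ⊆ Ω) (hne : ∀ w ∈ sphere z (dist p z), a w ≠ 0)
    (hp : ∃ C : ℝ, ∀ b : ℂ → ℂ, Differentiable ℂ b →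
      ‖b p - l b * a p‖ ≤ C * moduliDist Ω α a b) :
    ∃ C : ℝ, ∀ b : ℂ → ℂ, Differentiable ℂ b → ∀ w ∈ closedBall z (dist p z),
      ‖b w - l b * a w‖ ≤ C * moduliDist Ω α a b := by
  set ρ := dist p z with hρ
  have hρ0 : 0 < ρ := dist_pos.2 hpz
  have hpS : p ∈ sphere z ρ := rfl
  obtain ⟨C₁, hC₁⟩ := hp
  obtain ⟨C₂, hC₂⟩ := exists_norm_deriv_div_le α hΩ hbd ha (isCompact_sphere z ρ) hsub hne
  obtain ⟨A, hA⟩ := (isCompact_sphere z ρ).exists_bound_of_continuousOn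
    ha.continuous.continuousOn
  have hA0 : 0 ≤ A := (norm_nonneg _).trans (hA p hpS)
  refine ⟨A * (C₂ * ρ * (2 * Real.pi) + C₁ / ‖a p‖), fun b hb => ?_⟩
  set D := moduliDist Ω α a b
  have hfr : ∀ w ∈ frontier (ball z ρ), ‖b w - l b * a w‖ ≤
      A * (C₂ * ρ * (2 * Real.pi) + C₁ / ‖a p‖) * D := by
    rw [frontier_ball z hρ0.ne']
    intro w hw
    obtain ⟨θ₀, hθ₀, hpθ⟩ : p ∈ circleMap z ρ '' Ioc 0 (2 * Real.pi) := by
      rw [image_circleMap_Ioc, abs_of_pos hρ0]; exact hpS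
    obtain ⟨θ₁, hθ₁, hwθ⟩ : w ∈ circleMap z ρ '' Ioc 0 (2 * Real.pi) := by
      rw [image_circleMap_Ioc, abs_of_pos hρ0]; exact hw
    have h0 : 0 ≤ C₂ * D := (norm_nonneg _).trans (hC₂ b hb p hpS)
    have hmem : ∀ θ, circleMap z ρ θ ∈ sphere z ρ := circleMap_mem_sphere z hρ0.le
    -- The quotient is compared along the circle only, as a function of the angle: it may have poles
    -- inside the disc.
    have h1 : ‖b (circleMap z ρ θ₁) / a (circleMap z ρ θ₁) -
        b (circleMap z ρ θ₀) / a (circleMap z ρ θ₀)‖ ≤ C₂ * D * ρ * ‖θ₁ - θ₀‖ := by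
      refine Convex.norm_image_sub_le_of_norm_hasDerivWithin_le
        (f := fun θ => b (circleMap z ρ θ) / a (circleMap z ρ θ))
        (f' := fun θ => deriv (circleMap z ρ) θ * deriv (fun w => b w / a w) (circleMap z ρ θ))
        (s := univ) (fun θ _ => ?_) (fun θ _ => ?_) convex_univ (mem_univ _) (mem_univ _)
      · have h2 : HasDerivAt (fun w => b w / a w) _ (circleMap z ρ θ) :=
          ((hb _).div (ha _) (hne _ (hmem θ))).hasDerivAt
        have h3 := HasDerivAt.scomp θ h2 (differentiable_circleMap z ρ θ).hasDerivAt
        exact h3.hasDerivWithinAt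
      · have h4 := hC₂ b hb _ (hmem θ)
        rw [norm_mul, mul_comm]
        have h5 : ‖deriv (circleMap z ρ) θ‖ = ρ := by
          simp [abs_of_pos hρ0]
        rw [h5]
        gcongr
    rw [hpθ, hwθ] at h1
    have h6 : ‖θ₁ - θ₀‖ ≤ 2 * Real.pi := by
      rw [Real.norm_eq_abs, abs_le]
      constructor <;> linarith [hθ₀.1, hθ₀.2, hθ₁.1, hθ₁.2]
    have h7 : b w - l b * a w = a w * ((b w / a w - b p / a p) + (b p - l b * a p) / a p) := by
      have := hne w hw
      have := hne p hpS
      field_simp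
      ring
    rw [h7, norm_mul, mul_assoc A]
    refine mul_le_mul (hA w hw) ?_ (norm_nonneg _) hA0
    refine (norm_add_le _ _).trans ?_
    rw [norm_div, add_mul]
    refine add_le_add (h1.trans ?_) ?_
    · calc C₂ * D * ρ * ‖θ₁ - θ₀‖ ≤ C₂ * D * ρ * (2 * Real.pi) := by gcongr
        _ = _ := by ring
    · rw [div_mul_eq_mul_div]
      gcongr
      exact hC₁ b hb
  intro w hw
  -- Unlike the quotient, `b - l a` is entire, so zeros of `a` inside the disc do no harm.
  refine Complex.norm_le_of_forall_mem_frontier_norm_le isBounded_ball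
    (f := fun w => b w - l b * a w) ?_ hfr (by rwa [closure_ball z hρ0.ne'])
  exact (hb.sub (ha.const_mul _)).diffContOnCl

lemma Differentiable.eventually_ne_zero_nhdsNE (ha : Differentiable ℂ a) {z₀ : ℂ}
    (haz₀ : a z₀ ≠ 0) (z : ℂ) : ∀ᶠ w in 𝓝[≠] z, a w ≠ 0 := by
  have han : AnalyticOnNhd ℂ a univ := fun w _ => ha.analyticAt w
  refine (han z (mem_univ z)).eventually_eq_zero_or_eventually_ne_zero.resolve_left fun h => ?_
  exact haz₀ (han.eqOn_zero_of_preconnected_of_eventuallyEq_zero isPreconnected_univ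
    (mem_univ z) h (mem_univ z₀))

/-- The set of centres with such a bound is open, contains `z₀`, and is relatively closed in `Ω`;
connectedness does the rest. For closedness at `z`, a nearby good point `p` gives a circle around
`z` through `p` that is free of zeros, even if `a z = 0`. -/
lemma exists_norm_sub_le_on_ball (hΩ : IsOpen Ω) (hbd : Bornology.IsBounded Ω)
    (hconn : IsPreconnected Ω) (ha : Differentiable ℂ a) {z₀ : ℂ} (hz₀ : z₀ ∈ Ω)
    (haz₀ : a z₀ ≠ 0) {z : ℂ} (hz : z ∈ Ω) :
    ∃ r > 0, ∃ C : ℝ, ∀ b : ℂ → ℂ, Differentiable ℂ b → ∀ w ∈ ball z r,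
      ‖b w - b z₀ / a z₀ * a w‖ ≤ C * moduliDist Ω α a b := by
  set S : Set ℂ := {z | ∃ r > 0, ∃ C : ℝ, ∀ b : ℂ → ℂ, Differentiable ℂ b → ∀ w ∈ ball z r,
      ‖b w - b z₀ / a z₀ * a w‖ ≤ C * moduliDist Ω α a b} with hS
  have hSo : IsOpen S := by
    rw [Metric.isOpen_iff]
    rintro z ⟨r, hr, C, hC⟩
    refine ⟨r, hr, fun w hw => ?_⟩
    obtain ⟨ε, hε, hsub⟩ := Metric.isOpen_iff.1 isOpen_ball w hw
    exact ⟨ε, hε, C, fun b hb v hv => hC b hb v (hsub hv)⟩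
  refine hconn.subset_of_closure_inter_subset hSo
    ⟨z₀, hz₀, exists_norm_sub_le_on_closedBall_center hΩ hbd ha hz₀ haz₀⟩ ?_ hz
  rintro z ⟨hzc, hzΩ⟩
  obtain ⟨ε₁, hε₁, hsub₁⟩ := Metric.isOpen_iff.1 hΩ z hzΩ
  obtain ⟨ε₂, hε₂, hsub₂⟩ := Metric.mem_nhdsWithin_iff.1
    (ha.eventually_ne_zero_nhdsNE haz₀ z)
  obtain ⟨p, hpS, hpd⟩ := Metric.mem_closure_iff.1 hzc (min ε₁ ε₂) (lt_min hε₁ hε₂)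
  rcases eq_or_ne p z with rfl | hpz
  · exact hpS
  rw [dist_comm] at hpd
  obtain ⟨r, hr, C, hC⟩ := hpS
  have hρ0 : 0 < dist p z := dist_pos.2 hpz
  obtain ⟨C', hC'⟩ := exists_norm_sub_le_on_closedBall_of_mem_sphere hΩ hbd ha
    (fun b => b z₀ / a z₀) hpz
    (fun w hw => hsub₁ (by rw [mem_ball, mem_sphere.1 hw]; exact hpd.trans_le (min_le_left _ _)))
    (fun w hw => hsub₂ ⟨by rw [mem_ball, mem_sphere.1 hw]; exact hpd.trans_le (min_le_right _ _),
      fun h => by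
        rw [mem_singleton_iff.1 h, mem_sphere, dist_self] at hw
        exact hρ0.ne hw⟩)
    ⟨C, fun b hb => hC b hb p (mem_ball_self hr)⟩
  exact ⟨dist p z, hρ0, C', fun b hb w hw => hC' b hb w (ball_subset_closedBall hw)⟩

/-- Interior estimate: on compact subsets of `Ω`, `b` is close to a fixed multiple of `a`, together
with its derivative. -/
lemma exists_norm_sub_le_on_compact (hΩ : IsOpen Ω) (hbd : Bornology.IsBounded Ω)
    (hconn : IsPreconnected Ω) (ha : Differentiable ℂ a) {z₀ : ℂ} (hz₀ : z₀ ∈ Ω)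
    (haz₀ : a z₀ ≠ 0) {K : Set ℂ} (hK : IsCompact K) (hKΩ : K ⊆ Ω) :
    ∃ C : ℝ, ∀ b : ℂ → ℂ, Differentiable ℂ b → ∀ w ∈ K,
      ‖b w - b z₀ / a z₀ * a w‖ ≤ C * moduliDist Ω α a b ∧
      ‖deriv b w - b z₀ / a z₀ * deriv a w‖ ≤ C * moduliDist Ω α a b := by
  refine hK.induction_on (p := fun K => ∃ C : ℝ, ∀ b : ℂ → ℂ, Differentiable ℂ b → ∀ w ∈ K,
      ‖b w - b z₀ / a z₀ * a w‖ ≤ C * moduliDist Ω α a b ∧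
      ‖deriv b w - b z₀ / a z₀ * deriv a w‖ ≤ C * moduliDist Ω α a b)
    ⟨0, by simp⟩ ?_ ?_ fun z hz => ?_
  · rintro s t hst ⟨C, hC⟩
    exact ⟨C, fun b hb w hw => hC b hb w (hst hw)⟩
  · rintro s t ⟨C₁, hC₁⟩ ⟨C₂, hC₂⟩
    refine ⟨max C₁ C₂, fun b hb w hw => ?_⟩
    have hD := moduliDist_nonneg Ω α a b
    have m1 := mul_le_mul_of_nonneg_right (le_max_left C₁ C₂) hD
    have m2 := mul_le_mul_of_nonneg_right (le_max_right C₁ C₂) hD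
    rcases hw with hw | hw
    · exact ⟨(hC₁ b hb w hw).1.trans m1, (hC₁ b hb w hw).2.trans m1⟩
    · exact ⟨(hC₂ b hb w hw).1.trans m2, (hC₂ b hb w hw).2.trans m2⟩
  · obtain ⟨r, hr, C, hC⟩ := exists_norm_sub_le_on_ball (α := α) hΩ hbd hconn ha hz₀ haz₀ (hKΩ hz)
    -- Cauchy's estimate for the derivative uses circles of radius `r / 3`, which stay in `ball z r`
    -- because `1/2 + 1/3 < 1`.
    refine ⟨ball z (r / 2), mem_nhdsWithin_of_mem_nhds (ball_mem_nhds z (by positivity)),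
      max C (C / (r / 3)), fun b hb w hw => ?_⟩
    have hD := moduliDist_nonneg Ω α a b
    have hw' : dist w z < r / 2 := hw
    constructor
    · refine (hC b hb w ?_).trans (mul_le_mul_of_nonneg_right (le_max_left _ _) hD)
      rw [mem_ball]
      linarith
    · have hd : deriv (fun v => b v - b z₀ / a z₀ * a v) w =
          deriv b w - b z₀ / a z₀ * deriv a w := by
        rw [deriv_fun_sub (hb w) ((ha w).const_mul _), deriv_const_mul _ (ha w)]
      rw [← hd]
      refine (Complex.norm_deriv_le_of_forall_mem_sphere_norm_le (R := r / 3) (by positivity)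
        (hb.sub (ha.const_mul _)).diffContOnCl (C := C * moduliDist Ω α a b)
        fun v hv => hC b hb v ?_).trans ?_
      · have := dist_triangle v w z
        rw [mem_sphere.1 hv] at this
        rw [mem_ball]
        linarith
      · rw [mul_div_right_comm]
        exact mul_le_mul_of_nonneg_right (le_max_right _ _) hD

end Interior

/-! ### A Poincaré inequality below a graph, and boundary charts. -/

lemma sq_lintegral_le_measure_mul_lintegral_sq {X : Type*} [MeasurableSpace X] {μ : Measure X}
    {f : X → ℝ≥0∞} (hf : AEMeasurable f μ) :
    (∫⁻ x, f x ∂μ) ^ 2 ≤ μ univ * ∫⁻ x, f x ^ 2 ∂μ := by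
  have h := ENNReal.lintegral_mul_le_Lp_mul_Lq μ Real.HolderConjugate.two_two hf
    (aemeasurable_const (b := (1 : ℝ≥0∞)))
  simp only [Pi.mul_apply, mul_one, lintegral_const, ENNReal.rpow_two, one_pow, one_mul] at h
  have hs : ∀ x : ℝ≥0∞, (x ^ (1 / 2 : ℝ)) ^ 2 = x := fun x => by
    rw [← ENNReal.rpow_natCast, ← ENNReal.rpow_mul]
    norm_num
  calc _ ≤ ((∫⁻ x, f x ^ 2 ∂μ) ^ (1 / 2 : ℝ) * μ univ ^ (1 / 2 : ℝ)) ^ 2 := by gcongr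
    _ = _ := by rw [mul_pow, hs, hs, mul_comm]

/-- The fundamental theorem of calculus followed by the Cauchy–Schwarz inequality. -/
lemma enorm_sub_sq_le_mul_lintegral_deriv_sq {g g' : ℝ → ℂ} {x y : ℝ} (hxy : x ≤ y)
    (hg : ∀ t ∈ Icc x y, HasDerivAt g (g' t) t) (hc : ContinuousOn g' (Icc x y)) :
    ‖g y - g x‖ₑ ^ 2 ≤ ENNReal.ofReal (y - x) * ∫⁻ t in Ioc x y, ‖g' t‖ₑ ^ 2 := by
  have hint : IntervalIntegrable g' volume x y := by
    apply ContinuousOn.intervalIntegrable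
    rwa [uIcc_of_le hxy]
  rw [← intervalIntegral.integral_eq_sub_of_hasDerivAt (f' := g')
    (fun t ht => hg t (by rwa [uIcc_of_le hxy] at ht)) hint, intervalIntegral.integral_of_le hxy]
  have hm : AEMeasurable (fun t => ‖g' t‖ₑ) (volume.restrict (Ioc x y)) :=
    (((intervalIntegrable_iff_integrableOn_Ioc_of_le hxy).1 hint).aestronglyMeasurable).enorm
  calc _ ≤ (∫⁻ t in Ioc x y, ‖g' t‖ₑ) ^ 2 := by
        gcongr
        exact enorm_integral_le_lintegral_enorm _
    _ ≤ _ := by simpa using sq_lintegral_le_measure_mul_lintegral_sq hm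

lemma enorm_add_sq_le {F : Type*} [NormedAddCommGroup F] (x y : F) :
    ‖x + y‖ₑ ^ 2 ≤ 2 * ‖x‖ₑ ^ 2 + 2 * ‖y‖ₑ ^ 2 := by
  simp only [enorm_sq_eq_ofReal]
  rw [← ENNReal.ofReal_ofNat 2, ← ENNReal.ofReal_mul (by positivity),
    ← ENNReal.ofReal_mul (by positivity), ← ENNReal.ofReal_add (by positivity) (by positivity)]
  apply ENNReal.ofReal_le_ofReal
  have h := norm_add_le x y
  nlinarith [sq_nonneg (‖x‖ - ‖y‖), norm_nonneg (x + y)]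

/-- A Poincaré inequality on the part of a box below a graph, with a bound on the bottom side. -/
lemma lintegral_subgraph_sq_le {r k : ℝ} {ψ : ℝ → ℝ} (hψ : Continuous ψ)
    {g g' : ℝ × ℝ → ℂ} (hg'm : Measurable g')
    (hg : ∀ s ∈ Ioo (-r) r, ∀ t ∈ Icc (-k) k, HasDerivAt (fun τ => g (s, τ)) (g' (s, t)) t)
    (hc : ∀ s ∈ Ioo (-r) r, ContinuousOn (fun τ => g' (s, τ)) (Icc (-k) k)) {M : ℝ≥0∞}
    (hM : ∀ s ∈ Ioo (-r) r, ‖g (s, -k)‖ₑ ^ 2 ≤ M) :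
    ∫⁻ x in (Ioo (-r) r ×ˢ Ioo (-k) k) ∩ {x | x.2 < ψ x.1}, ‖g x‖ₑ ^ 2 ≤
      2 * M * (ENNReal.ofReal (2 * k) * ENNReal.ofReal (2 * r)) +
      2 * ENNReal.ofReal (2 * k) * ENNReal.ofReal (2 * k) *
        ∫⁻ x in (Ioo (-r) r ×ˢ Ioo (-k) k) ∩ {x | x.2 < ψ x.1}, ‖g' x‖ₑ ^ 2 := by
  set R : Set (ℝ × ℝ) := (Ioo (-r) r ×ˢ Ioo (-k) k) ∩ {x | x.2 < ψ x.1} with hR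
  have hRo : IsOpen R := (isOpen_Ioo.prod isOpen_Ioo).inter
    (isOpen_lt continuous_snd (hψ.comp continuous_fst))
  set G : ℝ × ℝ → ℝ≥0∞ := R.indicator fun x => ‖g' x‖ₑ ^ 2 with hG
  have hGm : Measurable G := (hg'm.enorm.pow_const 2).indicator hRo.measurableSet
  set J : ℝ → ℝ≥0∞ := fun s => ∫⁻ τ, G (s, τ) with hJ
  have hJm : Measurable J := hGm.lintegral_prod_right'
  have hpt : ∀ x ∈ R, ‖g x‖ₑ ^ 2 ≤ 2 * M + 2 * ENNReal.ofReal (2 * k) * J x.1 := by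
    rintro ⟨s, t⟩ ⟨⟨hs, ht⟩, hlt⟩
    have hs : s ∈ Ioo (-r) r := hs
    have ht : t ∈ Ioo (-k) k := ht
    have hlt : t < ψ s := hlt
    have hI : Icc (-k) t ⊆ Icc (-k) k := Icc_subset_Icc_right ht.2.le
    have h1 := enorm_sub_sq_le_mul_lintegral_deriv_sq (g := fun τ => g (s, τ)) ht.1.le
      (fun τ hτ => hg s hs τ (hI hτ)) ((hc s hs).mono hI)
    -- The segment from the bottom of the box up to a point below the graph stays below the graph.
    -- Hence continuity of `ψ` is enough.
    have h2 : ∫⁻ τ in Ioc (-k) t, ‖g' (s, τ)‖ₑ ^ 2 ≤ J s := by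
      rw [← lintegral_indicator measurableSet_Ioc]
      refine lintegral_mono fun τ => ?_
      by_cases hτ : τ ∈ Ioc (-k) t
      · have : (s, τ) ∈ R := ⟨⟨hs, hτ.1, hτ.2.trans_lt ht.2⟩, hτ.2.trans_lt hlt⟩
        simp [hG, indicator_of_mem hτ, indicator_of_mem this]
      · simp [indicator_of_notMem hτ]
    calc ‖g (s, t)‖ₑ ^ 2 = ‖g (s, -k) + (g (s, t) - g (s, -k))‖ₑ ^ 2 := by
          rw [add_sub_cancel]
      _ ≤ 2 * ‖g (s, -k)‖ₑ ^ 2 + 2 * ‖g (s, t) - g (s, -k)‖ₑ ^ 2 := enorm_add_sq_le _ _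
      _ ≤ 2 * M + 2 * (ENNReal.ofReal (2 * k) * J s) := by
          gcongr
          · exact hM s hs
          · refine h1.trans ?_
            gcongr
            linarith [ht.2]
      _ = _ := by rw [mul_assoc]
  calc ∫⁻ x in R, ‖g x‖ₑ ^ 2
      ≤ ∫⁻ x in R, (2 * M + 2 * ENNReal.ofReal (2 * k) * J x.1) :=
        setLIntegral_mono' hRo.measurableSet hpt
    _ ≤ ∫⁻ x in Ioo (-r) r ×ˢ Ioo (-k) k, (2 * M + 2 * ENNReal.ofReal (2 * k) * J x.1) :=
        lintegral_mono_set inter_subset_left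
    _ = ∫⁻ s in Ioo (-r) r, ∫⁻ _ in Ioo (-k) k, (2 * M + 2 * ENNReal.ofReal (2 * k) * J s) := by
        rw [Measure.volume_eq_prod, setLIntegral_prod]
        exact ((hJm.comp measurable_fst).const_mul _ |>.const_add _).aemeasurable
    _ = ∫⁻ s in Ioo (-r) r, (2 * M * ENNReal.ofReal (2 * k) +
          2 * ENNReal.ofReal (2 * k) * ENNReal.ofReal (2 * k) * J s) := by
        congr 1
        ext s
        rw [setLIntegral_const, Real.volume_Ioo, sub_neg_eq_add, ← two_mul]
        ring
    _ = 2 * M * ENNReal.ofReal (2 * k) * ENNReal.ofReal (2 * r) +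
          2 * ENNReal.ofReal (2 * k) * ENNReal.ofReal (2 * k) * ∫⁻ s in Ioo (-r) r, J s := by
        rw [lintegral_add_left measurable_const, lintegral_const_mul _ hJm, setLIntegral_const,
          Real.volume_Ioo, sub_neg_eq_add, ← two_mul r]
    _ ≤ _ := by
        rw [mul_assoc (2 * M)]
        gcongr
        rw [← lintegral_indicator hRo.measurableSet, Measure.volume_eq_prod,
          lintegral_prod _ hGm.aemeasurable]
        exact setLIntegral_le_lintegral _ _

/-- The rigid motion `(s, t) ↦ p + c (s + t i)`. -/
def boxChart (p : ℂ) (c : Circle) : ℝ × ℝ ≃ₜ ℂ :=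
  (Complex.equivRealProdCLM.symm.toHomeomorph.trans (rotation c).toHomeomorph).trans
    (Homeomorph.addLeft p)

lemma boxChart_apply (p : ℂ) (c : Circle) (s t : ℝ) :
    boxChart p c (s, t) = p + (c : ℂ) * ((s : ℂ) + (t : ℂ) * Complex.I) := by
  simp [boxChart, Complex.equivRealProdCLM_symm_apply]

lemma measurePreserving_boxChart (p : ℂ) (c : Circle) : MeasurePreserving (boxChart p c) :=
  (measurePreserving_add_left volume p).comp
    ((rotation c).measurePreserving.comp Complex.volume_preserving_equiv_real_prod.symm)

lemma hasDerivAt_boxChart (p : ℂ) (c : Circle) (s t : ℝ) :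
    HasDerivAt (fun τ => boxChart p c (s, τ)) ((c : ℂ) * Complex.I) t := by
  simp only [boxChart_apply]
  simpa using ((((hasDerivAt_id t).ofReal_comp.mul_const Complex.I).const_add (s : ℂ)).const_mul
    (c : ℂ)).const_add p

/-- Adapted coordinates around a boundary point, in a prescribed neighbourhood. -/
lemma HasContinuousBoundary.exists_box {Ω U : Set ℂ} (h : HasContinuousBoundary Ω)
    (hU : IsOpen U) {p : ℂ} (hp : p ∈ frontier Ω) (hpU : p ∈ U) :
    ∃ (c : Circle) (r k : ℝ) (ψ : ℝ → ℝ), 0 < r ∧ 0 < k ∧ Continuous ψ ∧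
      (∀ s ∈ Icc (-r) r, ∀ t ∈ Icc (-k) k, boxChart p c (s, t) ∈ U ∧
        (boxChart p c (s, t) ∈ Ω ↔ t < ψ s)) ∧
      ∀ s ∈ Icc (-r) r, -k < ψ s := by
  obtain ⟨c, r, h, ψ, hr, hh, hψ, hΩ⟩ := h p hp
  have hΩ' : ∀ s t : ℝ, |s| < r → |t| < h → (boxChart p c (s, t) ∈ Ω ↔ t < ψ s) := by
    intro s t hs ht
    rw [boxChart_apply]
    exact hΩ s t hs ht
  have h0 : boxChart p c (0, 0) = p := by simp [boxChart_apply]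
  -- If `ψ 0 < 0`, a whole neighbourhood of `p` would lie above the graph and miss `Ω`.
  have hψ0 : 0 ≤ ψ 0 := by
    by_contra! hneg
    have ho : IsOpen {x : ℝ × ℝ | |x.1| < r ∧ |x.2| < h ∧ ψ x.1 < x.2} :=
      (isOpen_lt continuous_fst.abs continuous_const).inter
        ((isOpen_lt continuous_snd.abs continuous_const).inter
          (isOpen_lt (hψ.comp continuous_fst) continuous_snd))
    obtain ⟨z, ⟨⟨s, t⟩, ⟨hs, ht, hlt⟩, rfl⟩, hzΩ⟩ := mem_closure_iff.1 (frontier_subset_closure hp)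
      _ ((boxChart p c).isOpenMap _ ho)
      ⟨(0, 0), ⟨by simpa using hr, by simpa using hh, by simpa using hneg⟩, h0⟩
    exact lt_asymm hlt ((hΩ' s t hs ht).1 hzΩ)
  obtain ⟨ε, hε, hsub⟩ := nhds_basis_closedBall.mem_iff.1
    ((hU.preimage (boxChart p c).continuous).mem_nhds (x := (0, 0)) (by simpa [h0] using hpU))
  -- Halving `h`, and `r` below, lets the chart apply on closed boxes. The width is chosen after
  -- `k`, small enough that `ψ > -k` on it: the bottom side then lies in `Ω`.
  set k := min ε (h / 2) with hk
  have hk0 : 0 < k := lt_min hε (by positivity)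
  obtain ⟨δ, hδ, hδψ⟩ := nhds_basis_closedBall.mem_iff.1
    ((isOpen_lt continuous_const hψ).mem_nhds (x := 0) (show -k < ψ 0 by linarith))
  refine ⟨c, min ε (min (r / 2) δ), k, ψ, lt_min hε (lt_min (by positivity) hδ), hk0, hψ,
    fun s hs t ht => ⟨hsub ?_, hΩ' s t ?_ ?_⟩, fun s hs => hδψ ?_⟩
  · rw [← closedBall_prod_same]
    simp only [mem_prod, mem_closedBall_zero_iff, Real.norm_eq_abs]
    exact ⟨(abs_le.2 hs).trans (min_le_left _ _), (abs_le.2 ht).trans (min_le_left _ _)⟩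
  · have := (abs_le.2 hs).trans ((min_le_right _ _).trans (min_le_left _ _))
    linarith
  · have := (abs_le.2 ht).trans (min_le_right _ _)
    linarith
  · rw [mem_closedBall_zero_iff, Real.norm_eq_abs]
    exact (abs_le.2 hs).trans ((min_le_right _ _).trans (min_le_right _ _))

/-! ### The `H¹` density of holomorphic functions. -/

/-- The integrand `|h|² + |h'|²` of the squared `H¹` norm of a holomorphic function. -/
def holoDensity (h : ℂ → ℂ) (z : ℂ) : ℝ≥0∞ := ‖h z‖ₑ ^ 2 + ‖deriv h z‖ₑ ^ 2

lemma holoDensity_eq_ofReal (h : ℂ → ℂ) (z : ℂ) :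
    holoDensity h z = ENNReal.ofReal (‖h z‖ ^ 2 + ‖deriv h z‖ ^ 2) := by
  rw [ENNReal.ofReal_add (by positivity) (by positivity), holoDensity, enorm_sq_eq_ofReal,
    enorm_sq_eq_ofReal]

lemma exists_holoDensity_le_on_compact {a : ℂ → ℂ} (ha : Differentiable ℂ a) {K : Set ℂ}
    (hK : IsCompact K) : ∃ A : ℝ≥0, ∀ z ∈ K, holoDensity a z ≤ A := by
  have hd : Continuous (deriv a) := ha.contDiff.continuous_deriv (n := 1) le_rfl
  have hc : Continuous fun z => ‖a z‖ ^ 2 + ‖deriv a z‖ ^ 2 :=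
    (ha.continuous.norm.pow 2).add (hd.norm.pow 2)
  obtain ⟨A, hA⟩ := hK.exists_bound_of_continuousOn hc.continuousOn
  refine ⟨A.toNNReal, fun z hz => ?_⟩
  rw [holoDensity_eq_ofReal]
  exact ENNReal.ofReal_le_ofReal ((Real.le_norm_self _).trans (hA z hz))

lemma holoDensity_add_le {h₁ h₂ : ℂ → ℂ} (d₁ : Differentiable ℂ h₁) (d₂ : Differentiable ℂ h₂)
    (z : ℂ) : holoDensity (fun w => h₁ w + h₂ w) z ≤
      2 * holoDensity h₁ z + 2 * holoDensity h₂ z := by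
  simp only [holoDensity]
  rw [deriv_fun_add (d₁ z) (d₂ z)]
  refine (add_le_add (enorm_add_sq_le _ _) (enorm_add_sq_le _ _)).trans_eq ?_
  ring

/-- Density of `h = a Q` in terms of `Q` and its derivative. -/
lemma holoDensity_mul_le {a Q h : ℂ → ℂ} {z : ℂ} (ha : DifferentiableAt ℂ a z)
    (hQ : DifferentiableAt ℂ Q z) (hh : h =ᶠ[𝓝 z] fun w => a w * Q w) :
    holoDensity h z ≤ holoDensity a z * (2 * ‖Q z‖ₑ ^ 2 + 2 * ‖deriv Q z‖ₑ ^ 2) := by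
  have h1 : ‖deriv h z‖ₑ ^ 2 ≤ 2 * (‖deriv a z‖ₑ ^ 2 * ‖Q z‖ₑ ^ 2) +
      2 * (‖a z‖ₑ ^ 2 * ‖deriv Q z‖ₑ ^ 2) := by
    rw [hh.deriv_eq, deriv_fun_mul ha hQ]
    refine (enorm_add_sq_le _ _).trans_eq ?_
    simp only [enorm_mul, mul_pow]
  have h2 : ‖h z‖ₑ ^ 2 = ‖a z‖ₑ ^ 2 * ‖Q z‖ₑ ^ 2 := by
    rw [hh.eq_of_nhds, enorm_mul, mul_pow]
  simp only [holoDensity, h2]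
  refine (add_le_add le_rfl h1).trans ?_
  set A := ‖a z‖ₑ ^ 2
  set A' := ‖deriv a z‖ₑ ^ 2
  set X := ‖Q z‖ₑ ^ 2
  set Y := ‖deriv Q z‖ₑ ^ 2
  -- The nonnegative terms missing from the product are added so that the right side factors.
  calc A * X + (2 * (A' * X) + 2 * (A * Y))
      ≤ A * X + (2 * (A' * X) + 2 * (A * Y)) + (A * X + 2 * (A' * Y)) := le_self_add
    _ = (A + A') * (2 * X + 2 * Y) := by ring

/-! ### Boundary estimate and global estimate with the multiplier `b z₀ / a z₀`. -/

section Estimates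

variable {Ω : Set ℂ} {α : ℝ} {a : ℂ → ℂ}

/-- Estimate near a boundary point where `a` does not vanish. -/
lemma exists_setLIntegral_holoDensity_le_near_frontier (hΩ : IsOpen Ω)
    (hbd : Bornology.IsBounded Ω) (hbdry : HasContinuousBoundary Ω) (hconn : IsPreconnected Ω)
    (ha : Differentiable ℂ a) {z₀ : ℂ} (hz₀ : z₀ ∈ Ω) (haz₀ : a z₀ ≠ 0) {p : ℂ}
    (hp : p ∈ frontier Ω) (hap : a p ≠ 0) :
    ∃ V ∈ 𝓝 p, ∃ C : ℝ≥0, ∀ b : ℂ → ℂ, Differentiable ℂ b →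
      ∫⁻ z in V ∩ Ω, holoDensity (fun w => b w - b z₀ / a z₀ * a w) z ≤
        C * ∫⁻ z in Ω, sobolevDensity (moduliDiff α a b) z := by
  have hopen : IsOpen {z | a z ≠ 0} := isOpen_ne_fun ha.continuous continuous_const
  obtain ⟨c, r, k, ψ, hr, hk, hψ, hbox, hbase⟩ := hbdry.exists_box hopen hp hap
  set Φ := boxChart p c with hΦ
  have hΦc : Continuous Φ := Φ.continuous
  set B : Set (ℝ × ℝ) := Ioo (-r) r ×ˢ Ioo (-k) k with hB
  -- `K₁` is the bottom side of the box, a compact subset of `Ω` where the interior estimate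
  -- applies; `K₂` is the whole closed box, which is free of zeros of `a` but may leave `Ω`.
  set K₁ : Set ℂ := Φ '' (Icc (-r) r ×ˢ {-k}) with hK₁
  set K₂ : Set ℂ := Φ '' (Icc (-r) r ×ˢ Icc (-k) k) with hK₂
  have hK₁c : IsCompact K₁ := (isCompact_Icc.prod isCompact_singleton).image hΦc
  have hK₂c : IsCompact K₂ := (isCompact_Icc.prod isCompact_Icc).image hΦc
  have haK₂ : ∀ z ∈ K₂, a z ≠ 0 := by
    rintro _ ⟨⟨s, t⟩, ⟨hs, ht⟩, rfl⟩
    exact (hbox s hs t ht).1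
  have hkk : -k ∈ Icc (-k) k := ⟨le_rfl, by linarith⟩
  have hK₁₂ : K₁ ⊆ K₂ := by
    refine image_mono (prod_mono le_rfl ?_)
    simpa using hkk.2
  have hK₁Ω : K₁ ⊆ Ω := by
    rintro _ ⟨⟨s, t⟩, ⟨hs, ht⟩, rfl⟩
    obtain rfl : t = -k := ht
    exact (hbox s hs _ hkk).2.2 (hbase s hs)
  have h0 : Φ (0, 0) = p := by simp [hΦ, boxChart_apply]
  have hBo : IsOpen B := isOpen_Ioo.prod isOpen_Ioo
  have hV : Φ '' B ∈ 𝓝 p := (Φ.isOpenMap B hBo).mem_nhds ⟨(0, 0), by simp [hB, hr, hk], h0⟩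
  have hpre : Φ ⁻¹' (Φ '' B ∩ Ω) = B ∩ {x | x.2 < ψ x.1} := by
    rw [preimage_inter, preimage_image_eq _ Φ.injective]
    ext ⟨s, t⟩
    simp only [mem_inter_iff, mem_preimage, mem_ofPred_eq, and_congr_right_iff]
    rintro ⟨hs, ht⟩
    exact (hbox s (Ioo_subset_Icc_self hs) t (Ioo_subset_Icc_self ht)).2
  have hTm : MeasurableSet (Φ '' B ∩ Ω) := ((Φ.isOpenMap B hBo).inter hΩ).measurableSet
  have hTK : Φ '' B ∩ Ω ⊆ K₂ ∩ Ω := inter_subset_inter_left _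
    (image_mono (prod_mono Ioo_subset_Icc_self Ioo_subset_Icc_self))
  have hcv : ∀ f : ℂ → ℝ≥0∞, ∫⁻ z in Φ '' B ∩ Ω, f z =
      ∫⁻ x in B ∩ {x | x.2 < ψ x.1}, f (Φ x) := fun f => by
    rw [← hpre]
    exact ((measurePreserving_boxChart p c).setLIntegral_comp_preimage_emb
      Φ.measurableEmbedding f _).symm
  obtain ⟨C₁, hC₁⟩ := exists_norm_sub_le_on_compact (α := α) hΩ hbd hconn ha hz₀ haz₀ hK₁c hK₁Ω
  obtain ⟨C₂, hC₂⟩ := exists_setLIntegral_deriv_div_sq_le α hΩ hbd ha hK₂c haK₂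
  obtain ⟨A, hA⟩ := exists_holoDensity_le_on_compact ha hK₂c
  obtain ⟨N, hN⟩ := hK₁c.exists_bound_of_continuousOn (f := fun z => (a z)⁻¹)
    (ha.continuous.continuousOn.inv₀ fun z hz => haK₂ z (hK₁₂ hz))
  set M₀ : ℝ≥0 := ((N * C₁) ^ 2).toNNReal with hM₀
  set k' : ℝ≥0 := (2 * k).toNNReal with hk'
  set r' : ℝ≥0 := (2 * r).toNNReal with hr'
  refine ⟨Φ '' B, hV, A * (2 * (2 * M₀ * (k' * r') + 2 * k' * k' * C₂) + 2 * C₂),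
    fun b hb => ?_⟩
  set l := b z₀ / a z₀ with hl
  set D₂ := ∫⁻ z in Ω, sobolevDensity (moduliDiff α a b) z with hD₂
  set q' := deriv (fun w => b w / a w) with hq'
  have hq : ∀ z ∈ K₂, HasDerivAt (fun w => b w / a w - l) (q' z) z := fun z hz =>
    (((hb z).div (ha z) (haK₂ z hz)).hasDerivAt).sub_const l
  have hq'm : Measurable q' := measurable_deriv _
  have hder : ∫⁻ z in Φ '' B ∩ Ω, ‖q' z‖ₑ ^ 2 ≤ C₂ * D₂ := hC₂ b hb _ hTK hTm
  have hcI : ‖(c : ℂ) * Complex.I‖ₑ = 1 := by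
    rw [← ofReal_norm, norm_mul, Circle.norm_coe]
    simp
  have hval : ∫⁻ z in Φ '' B ∩ Ω, ‖b z / a z - l‖ₑ ^ 2 ≤
      2 * (M₀ * D₂) * (k' * r') + 2 * k' * k' * (C₂ * D₂) := by
    have hmemK₂ : ∀ s ∈ Ioo (-r) r, ∀ t ∈ Icc (-k) k, Φ (s, t) ∈ K₂ := fun s hs t ht =>
      ⟨(s, t), ⟨Ioo_subset_Icc_self hs, ht⟩, rfl⟩
    have key := lintegral_subgraph_sq_le (r := r) (k := k) hψ
      (g := fun x => b (Φ x) / a (Φ x) - l)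
      (g' := fun x => (c * Complex.I) * q' (Φ x))
      ((hq'm.comp hΦc.measurable).const_mul _)
      (fun s hs t ht => HasDerivAt.scomp t (hq _ (hmemK₂ s hs t ht)) (hasDerivAt_boxChart p c s t))
      (fun s hs => by
        have hcq : ContinuousOn q' {z | a z ≠ 0} :=
          (DifferentiableOn.deriv (fun z hz => ((hb z).div (ha z)
            hz).differentiableWithinAt) hopen).continuousOn
        exact continuousOn_const.mul (hcq.comp (by fun_prop)
          fun t ht => haK₂ _ (hmemK₂ s hs t ht)))
      (M := M₀ * D₂) (fun s hs => by
        have hK : Φ (s, -k) ∈ K₁ := ⟨(s, -k), ⟨Ioo_subset_Icc_self hs, rfl⟩, rfl⟩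
        have h1 := (hC₁ b hb _ hK).1
        have h2 := hN _ hK
        have h3 : b (Φ (s, -k)) / a (Φ (s, -k)) - l =
            (a (Φ (s, -k)))⁻¹ * (b (Φ (s, -k)) - l * a (Φ (s, -k))) := by
          have := haK₂ _ (hK₁₂ hK)
          field_simp
        rw [hD₂, ← ofReal_moduliDist_sq hΩ hbd ha hb, ← ENNReal.ofReal_coe_nnreal,
          ← ENNReal.ofReal_mul (by positivity), enorm_sq_eq_ofReal, h3, norm_mul, hM₀,
          Real.coe_toNNReal _ (by positivity), ← mul_pow, mul_assoc]
        apply ENNReal.ofReal_le_ofReal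
        gcongr
        exact (norm_nonneg _).trans h2)
    rw [hcv]
    refine key.trans ?_
    simp only [enorm_mul, hcI, one_mul]
    rw [← hcv fun z => ‖q' z‖ₑ ^ 2]
    gcongr <;> exact le_rfl
  calc ∫⁻ z in Φ '' B ∩ Ω, holoDensity (fun w => b w - l * a w) z
      ≤ ∫⁻ z in Φ '' B ∩ Ω, A * (2 * ‖b z / a z - l‖ₑ ^ 2 + 2 * ‖q' z‖ₑ ^ 2) := by
        refine setLIntegral_mono' hTm fun z hz => ?_
        have hzK := (hTK hz).1
        have hm := holoDensity_mul_le (h := fun w => b w - l * a w) (ha z)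
          (hq z hzK).differentiableAt (by
            filter_upwards [hopen.mem_nhds (haK₂ z hzK)] with w hw
            have hw' : a w ≠ 0 := hw
            field_simp)
        rw [(hq z hzK).deriv] at hm
        refine hm.trans ?_
        gcongr
        exact hA z hzK
    _ = A * (2 * (∫⁻ z in Φ '' B ∩ Ω, ‖b z / a z - l‖ₑ ^ 2) +
          2 * ∫⁻ z in Φ '' B ∩ Ω, ‖q' z‖ₑ ^ 2) := by
        rw [lintegral_const_mul' _ _ ENNReal.coe_ne_top, lintegral_add_right,
          lintegral_const_mul' _ _ (by simp), lintegral_const_mul' _ _ (by simp)]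
        exact (hq'm.enorm.pow_const 2).const_mul 2
    _ ≤ A * (2 * (2 * (M₀ * D₂) * (k' * r') + 2 * k' * k' * (C₂ * D₂)) + 2 * (C₂ * D₂)) := by
        gcongr
    _ = _ := by
        push_cast
        ring

/-- Global estimate with an unrestricted multiplier. -/
lemma exists_lintegral_holoDensity_le (hΩ : IsOpen Ω)
    (hbd : Bornology.IsBounded Ω) (hbdry : HasContinuousBoundary Ω) (hconn : IsPreconnected Ω)
    (ha : Differentiable ℂ a) {z₀ : ℂ} (hz₀ : z₀ ∈ Ω) (haz₀ : a z₀ ≠ 0)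
    (hfr : ∀ z ∈ frontier Ω, a z ≠ 0) :
    ∃ C : ℝ≥0, ∀ b : ℂ → ℂ, Differentiable ℂ b →
      ∫⁻ z in Ω, holoDensity (fun w => b w - b z₀ / a z₀ * a w) z ≤
        C * ∫⁻ z in Ω, sobolevDensity (moduliDiff α a b) z := by
  -- Induction over the compact closure leaves a local bound to prove at each of its points: the
  -- interior estimate in `Ω`, the graph estimate on the frontier.
  obtain ⟨C, hC⟩ := hbd.isCompact_closure.induction_on
    (p := fun T => ∃ C : ℝ≥0, ∀ b : ℂ → ℂ, Differentiable ℂ b →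
      ∫⁻ z in T ∩ Ω, holoDensity (fun w => b w - b z₀ / a z₀ * a w) z ≤
        C * ∫⁻ z in Ω, sobolevDensity (moduliDiff α a b) z)
    ⟨0, by simp⟩
    (fun s t hst ⟨C, hC⟩ => ⟨C, fun b hb =>
      (lintegral_mono_set (inter_subset_inter_left _ hst)).trans (hC b hb)⟩)
    (fun s t ⟨C₁, hC₁⟩ ⟨C₂, hC₂⟩ => ⟨C₁ + C₂, fun b hb => by
      rw [union_inter_distrib_right, ENNReal.coe_add, add_mul]
      exact (lintegral_union_le _ _ _).trans (add_le_add (hC₁ b hb) (hC₂ b hb))⟩)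
    (fun z hz => by
      by_cases hzΩ : z ∈ Ω
      · obtain ⟨r, hr, hsub⟩ := nhds_basis_closedBall.mem_iff.1 (hΩ.mem_nhds hzΩ)
        obtain ⟨C, hC⟩ := exists_norm_sub_le_on_compact (α := α) hΩ hbd hconn ha hz₀ haz₀
          (isCompact_closedBall z r) hsub
        have hvol : volume (closedBall z r) ≠ ⊤ := measure_closedBall_lt_top.ne
        refine ⟨closedBall z r, mem_nhdsWithin_of_mem_nhds (closedBall_mem_nhds z hr),
          (2 * C ^ 2).toNNReal * (volume (closedBall z r)).toNNReal, fun b hb => ?_⟩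
        calc _ ≤ ∫⁻ w in closedBall z r, holoDensity (fun w => b w - b z₀ / a z₀ * a w) w :=
              lintegral_mono_set inter_subset_left
          _ ≤ ∫⁻ _ in closedBall z r, ENNReal.ofReal (2 * C ^ 2) *
                ∫⁻ z in Ω, sobolevDensity (moduliDiff α a b) z := by
              refine setLIntegral_mono' measurableSet_closedBall fun w hw => ?_
              rw [← ofReal_moduliDist_sq hΩ hbd ha hb, ← ENNReal.ofReal_mul (by positivity),
                holoDensity_eq_ofReal]
              apply ENNReal.ofReal_le_ofReal
              obtain ⟨h1, h2⟩ := hC b hb w hw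
              rw [deriv_fun_sub (hb w) ((ha w).const_mul _), deriv_const_mul _ (ha w)]
              have h3 := pow_le_pow_left₀ (norm_nonneg _) h1 2
              have h4 := pow_le_pow_left₀ (norm_nonneg _) h2 2
              linarith
          _ = _ := by
              rw [setLIntegral_const, ENNReal.coe_mul, ENNReal.coe_toNNReal hvol, mul_right_comm]
              rfl
      · obtain ⟨V, hV, h⟩ := exists_setLIntegral_holoDensity_le_near_frontier (α := α) hΩ hbd
          hbdry hconn ha hz₀ haz₀ (p := z) ⟨hz, by rwa [hΩ.interior_eq]⟩
          (hfr z ⟨hz, by rwa [hΩ.interior_eq]⟩)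
        exact ⟨V, mem_nhdsWithin_of_mem_nhds hV, h⟩)
  refine ⟨C, fun b hb => ?_⟩
  have := hC b hb
  rwa [inter_eq_self_of_subset_right subset_closure] at this

end Estimates

/-! ### Unimodular multiplier, and the zero signal. -/

section Estimates

variable {Ω : Set ℂ} {a : ℂ → ℂ}

/-- The point of the circle with the argument of `l` works; for `l = 0` the convention `arg 0 = 0`
still gives a valid choice. -/
lemma exists_circle_norm_sub_eq (l : ℂ) : ∃ c : Circle, ‖l - c‖ = |‖l‖ - 1| := by
  refine ⟨Circle.exp l.arg, ?_⟩
  have h : l - Circle.exp l.arg = ((‖l‖ - 1 : ℝ) : ℂ) * Circle.exp l.arg := by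
    rw [Circle.coe_exp]
    push_cast
    linear_combination -Complex.norm_mul_exp_arg_mul_I l
  rw [h, norm_mul, Circle.norm_coe, mul_one, Complex.norm_real, Real.norm_eq_abs]

lemma gaborWeight_le_one (z : ℂ) : gaborWeight z ≤ 1 := by
  rw [gaborWeight, Real.exp_le_one_iff]
  nlinarith [Real.pi_pos, sq_nonneg z.re]

/-- `W (|l a| - |b|)` and `W (|a| - |b|)` differ by `(|l| - 1) W |a|`. Squared and integrated over
`Ω`, this shows that `|l|` is close to `1`. -/
lemma norm_multiplier_sub_one_le (a b : ℂ → ℂ) (l z : ℂ) :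
    |‖l‖ - 1| * (gaborWeight z * ‖a z‖) ≤ ‖b z - l * a z‖ + ‖moduliDiff 1 a b z‖ := by
  have hW := gaborWeight_pos z
  have hW1 := gaborWeight_le_one z
  have h1 : (‖l‖ - 1) * (gaborWeight z * ‖a z‖) =
      gaborWeight z * (‖l * a z‖ - ‖b z‖) - moduliDiff 1 a b z := by
    rw [moduliDiff, norm_mul]
    ring
  calc |‖l‖ - 1| * (gaborWeight z * ‖a z‖) = |(‖l‖ - 1) * (gaborWeight z * ‖a z‖)| := by
        rw [abs_mul, abs_of_nonneg (a := gaborWeight z * ‖a z‖) (by positivity)]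
    _ ≤ |gaborWeight z * (‖l * a z‖ - ‖b z‖)| + |moduliDiff 1 a b z| := by
        rw [h1]
        exact abs_sub _ _
    _ ≤ _ := by
        refine add_le_add ?_ le_rfl
        rw [abs_mul, abs_of_pos hW, norm_sub_rev]
        calc _ ≤ 1 * |‖l * a z‖ - ‖b z‖| := by gcongr
          _ ≤ _ := by rw [one_mul]; exact abs_norm_sub_norm_le _ _

lemma lintegral_gaborWeight_mul_norm_sq_pos (hΩ : IsOpen Ω) (ha : Differentiable ℂ a) {z₀ : ℂ}
    (hz₀ : z₀ ∈ Ω) (haz₀ : a z₀ ≠ 0) :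
    0 < ∫⁻ z in Ω, ENNReal.ofReal (gaborWeight z * ‖a z‖) ^ 2 := by
  have hc : Continuous fun z => ENNReal.ofReal (gaborWeight z * ‖a z‖) ^ 2 :=
    (ENNReal.continuous_pow 2).comp (ENNReal.continuous_ofReal.comp
      (contDiff_gaborWeight.continuous.mul ha.continuous.norm))
  rw [setLIntegral_pos_iff hc.measurable]
  refine ((isOpen_ne_fun hc continuous_const).inter hΩ).measure_pos volume ⟨z₀, ?_, hz₀⟩
  have : 0 < gaborWeight z₀ * ‖a z₀‖ := mul_pos (gaborWeight_pos _) (norm_pos_iff.2 haz₀)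
  simpa using this

/-- Global estimate with a unimodular multiplier. -/
lemma exists_circle_lintegral_holoDensity_le (hΩ : IsOpen Ω)
    (hbd : Bornology.IsBounded Ω) (hbdry : HasContinuousBoundary Ω) (hconn : IsPreconnected Ω)
    (ha : Differentiable ℂ a) {z₀ : ℂ} (hz₀ : z₀ ∈ Ω) (haz₀ : a z₀ ≠ 0)
    (hfr : ∀ z ∈ frontier Ω, a z ≠ 0) :
    ∃ C : ℝ≥0, ∀ b : ℂ → ℂ, Differentiable ℂ b → ∃ c : Circle,
      ∫⁻ z in Ω, holoDensity (fun w => b w - c * a w) z ≤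
        C * ∫⁻ z in Ω, sobolevDensity (moduliDiff 1 a b) z := by
  obtain ⟨C, hC⟩ := exists_lintegral_holoDensity_le (α := 1) hΩ hbd hbdry hconn ha hz₀ haz₀ hfr
  obtain ⟨A, hA⟩ := exists_holoDensity_le_on_compact ha hbd.isCompact_closure
  set I := ∫⁻ z in Ω, ENNReal.ofReal (gaborWeight z * ‖a z‖) ^ 2 with hI
  have hI0 : I ≠ 0 := (lintegral_gaborWeight_mul_norm_sq_pos hΩ ha hz₀ haz₀).ne'
  have hvol : volume Ω ≠ ⊤ := hbd.measure_lt_top.ne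
  set I' : ℝ≥0 := (I⁻¹).toNNReal with hI'
  have hI'c : (I' : ℝ≥0∞) = I⁻¹ := ENNReal.coe_toNNReal (ENNReal.inv_ne_top.2 hI0)
  set v : ℝ≥0 := (volume Ω).toNNReal with hv
  have hvc : (v : ℝ≥0∞) = volume Ω := ENNReal.coe_toNNReal hvol
  refine ⟨2 * C + 2 * ((2 * C + 2) * I' * (A * v)), fun b hb => ?_⟩
  set l := b z₀ / a z₀ with hl
  set D₂ := ∫⁻ z in Ω, sobolevDensity (moduliDiff 1 a b) z with hD₂
  obtain ⟨c, hc⟩ := exists_circle_norm_sub_eq l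
  refine ⟨c, ?_⟩
  have h1 : ‖l - c‖ₑ ^ 2 * I ≤ (2 * C + 2) * D₂ := by
    calc ‖l - c‖ₑ ^ 2 * I = ∫⁻ z in Ω, ‖l - c‖ₑ ^ 2 *
          ENNReal.ofReal (gaborWeight z * ‖a z‖) ^ 2 := by
          rw [lintegral_const_mul' _ _ (by finiteness)]
      _ ≤ ∫⁻ z in Ω, (2 * holoDensity (fun w => b w - l * a w) z +
            2 * sobolevDensity (moduliDiff 1 a b) z) := by
          refine lintegral_mono fun z => ?_
          have h2 := norm_multiplier_sub_one_le a b l z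
          have hW := gaborWeight_pos z
          rw [enorm_sq_eq_ofReal, hc, ← ENNReal.ofReal_pow (by positivity),
            ← ENNReal.ofReal_mul (by positivity), ← mul_pow]
          have h3 : ENNReal.ofReal ((|‖l‖ - 1| * (gaborWeight z * ‖a z‖)) ^ 2) ≤
              2 * ‖b z - l * a z‖ₑ ^ 2 + 2 * ‖moduliDiff 1 a b z‖ₑ ^ 2 := by
            simp only [enorm_sq_eq_ofReal]
            rw [← ENNReal.ofReal_ofNat 2, ← ENNReal.ofReal_mul (by positivity),
              ← ENNReal.ofReal_mul (by positivity),
              ← ENNReal.ofReal_add (by positivity) (by positivity)]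
            apply ENNReal.ofReal_le_ofReal
            have h4 := pow_le_pow_left₀ (by positivity) h2 2
            nlinarith [sq_nonneg (‖b z - l * a z‖ - ‖moduliDiff 1 a b z‖)]
          refine h3.trans ?_
          unfold holoDensity sobolevDensity
          gcongr
          · exact le_self_add
          · rw [add_assoc]
            exact le_self_add
      _ = 2 * (∫⁻ z in Ω, holoDensity (fun w => b w - l * a w) z) + 2 * D₂ := by
          rw [lintegral_add_left, lintegral_const_mul' _ _ (by simp),
            lintegral_const_mul' _ _ (by simp)]
          have hm : Measurable fun w => b w - l * a w :=
            (hb.continuous.sub (ha.continuous.const_mul l)).measurable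
          exact ((hm.enorm.pow_const 2).add
            ((measurable_deriv _).enorm.pow_const 2)).const_mul 2
      _ ≤ 2 * (C * D₂) + 2 * D₂ := by
          gcongr
          exact hC b hb
      _ = _ := by ring
  have h2 : ‖l - c‖ₑ ^ 2 ≤ (2 * C + 2) * I' * D₂ := by
    rw [hI'c, mul_right_comm, ← div_eq_mul_inv]
    -- Dividing by `I` requires it to be finite, which holds because `W |a|` is bounded on the
    -- bounded set `Ω`.
    by_cases hIt : I = ⊤
    · have hle : I ≤ A * v := by
        rw [hvc, ← setLIntegral_const]
        refine setLIntegral_mono' hΩ.measurableSet fun z hz => ?_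
        refine le_trans ?_ (hA z (subset_closure hz))
        refine le_trans ?_ le_self_add
        rw [← ofReal_norm (a z)]
        gcongr
        exact mul_le_of_le_one_left (norm_nonneg _) (gaborWeight_le_one z)
      rw [hIt] at hle
      exact absurd hle (by simp; finiteness)
    · exact (ENNReal.le_div_iff_mul_le (Or.inl hI0) (Or.inl hIt)).2 h1
  have h3 : ∫⁻ z in Ω, holoDensity (fun w => (l - c) * a w) z ≤ ‖l - c‖ₑ ^ 2 * (A * v) := by
    rw [hvc, ← setLIntegral_const, ← lintegral_const_mul' _ _ (by finiteness)]
    refine setLIntegral_mono' hΩ.measurableSet fun z hz => ?_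
    refine le_trans (le_of_eq ?_) (mul_le_mul_right (hA z (subset_closure hz)) _)
    rw [holoDensity, holoDensity, deriv_const_mul _ (ha z)]
    simp only [enorm_mul, mul_pow, mul_add]
  calc ∫⁻ z in Ω, holoDensity (fun w => b w - c * a w) z
      = ∫⁻ z in Ω, holoDensity (fun w => (b w - l * a w) + (l - c) * a w) z := by
        congr 1
        ext z
        congr 1
        ext w
        ring
    _ ≤ ∫⁻ z in Ω, (2 * holoDensity (fun w => b w - l * a w) z +
          2 * holoDensity (fun w => (l - c) * a w) z) :=
        lintegral_mono fun z => holoDensity_add_le (hb.sub (ha.const_mul l)) (ha.const_mul _) z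
    _ = 2 * (∫⁻ z in Ω, holoDensity (fun w => b w - l * a w) z) +
          2 * ∫⁻ z in Ω, holoDensity (fun w => (l - c) * a w) z := by
        rw [lintegral_add_left, lintegral_const_mul' _ _ (by simp),
          lintegral_const_mul' _ _ (by simp)]
        have hm : Measurable fun w => b w - l * a w :=
          (hb.continuous.sub (ha.continuous.const_mul l)).measurable
        exact ((hm.enorm.pow_const 2).add
          ((measurable_deriv _).enorm.pow_const 2)).const_mul 2
    _ ≤ 2 * (C * D₂) + 2 * ((2 * C + 2) * I' * D₂ * (A * v)) := by
        gcongr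
        · exact hC b hb
        · exact h3.trans (mul_le_mul_left h2 _)
    _ = _ := by
        push_cast
        ring

/-- The case of a vanishing signal. -/
lemma exists_lintegral_holoDensity_le_zero (hΩ : IsOpen Ω) (hbd : Bornology.IsBounded Ω) :
    ∃ C : ℝ≥0, ∀ b : ℂ → ℂ, Differentiable ℂ b →
      ∫⁻ z in Ω, holoDensity b z ≤ C * ∫⁻ z in Ω, sobolevDensity (moduliDiff 1 0 b) z := by
  -- This is the purpose of the parameter `α`: with `a = 0` replaced by the nonvanishing function
  -- `1` at `α = 0`, the quotient is `b` itself and the pointwise estimate bounds `b'`.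
  have h10 : ∀ b : ℂ → ℂ, moduliDiff 1 0 b = moduliDiff 0 1 b := fun b => by
    ext z
    simp [moduliDiff]
  obtain ⟨C, hC⟩ := exists_setLIntegral_deriv_div_sq_le (a := 1) 0 hΩ hbd
    (differentiable_const 1) hbd.isCompact_closure (fun z _ => one_ne_zero)
  obtain ⟨N, hN⟩ := hbd.isCompact_closure.exists_bound_of_continuousOn
    (f := fun z => (gaborWeight z)⁻¹)
    (contDiff_gaborWeight.continuous.continuousOn.inv₀ fun z _ => (gaborWeight_pos z).ne')
  refine ⟨(N ^ 2).toNNReal + C, fun b hb => ?_⟩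
  have h1 := hC b hb Ω (fun z hz => ⟨subset_closure hz, hz⟩) hΩ.measurableSet
  simp only [Pi.one_apply, div_one] at h1
  have h2 : ∫⁻ z in Ω, ‖b z‖ₑ ^ 2 ≤
      (N ^ 2).toNNReal * ∫⁻ z in Ω, sobolevDensity (moduliDiff 0 1 b) z := by
    rw [← lintegral_const_mul' _ _ ENNReal.coe_ne_top]
    refine setLIntegral_mono' hΩ.measurableSet fun z hz => ?_
    have h3 : ‖b z‖ = (gaborWeight z)⁻¹ * ‖moduliDiff 0 1 b z‖ := by
      have hW := gaborWeight_pos z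
      simp only [moduliDiff, zero_mul, zero_sub, norm_mul, norm_neg, abs_norm,
        Real.norm_eq_abs, abs_of_pos hW]
      field_simp
    have h4 : ‖(gaborWeight z)⁻¹‖ ≤ N := hN z (subset_closure hz)
    rw [Real.norm_of_nonneg (inv_nonneg.2 (gaborWeight_pos z).le)] at h4
    rw [sobolevDensity_eq_ofReal, enorm_sq_eq_ofReal, ← ENNReal.ofReal_coe_nnreal,
      Real.coe_toNNReal _ (by positivity), ← ENNReal.ofReal_mul (by positivity)]
    apply ENNReal.ofReal_le_ofReal
    rw [h3, mul_pow]
    have hWi := inv_pos.2 (gaborWeight_pos z)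
    gcongr
    rw [add_assoc]
    exact le_add_of_nonneg_right (by positivity)
  have h5 : ∫⁻ z in Ω, holoDensity b z =
      (∫⁻ z in Ω, ‖b z‖ₑ ^ 2) + ∫⁻ z in Ω, ‖deriv b z‖ₑ ^ 2 :=
    lintegral_add_left (hb.continuous.enorm.measurable.pow_const 2) _
  rw [h5, h10, ENNReal.coe_add, add_mul]
  exact add_le_add h2 h1

end Estimates

/-! ### Return to the Gabor transform. -/

section GaborTransform

/-- The Sobolev density of the difference of Gabor transforms is controlled by the holomorphic
density of the difference of Bargmann transforms. -/
lemma exists_sobolevDensity_gaborTransform_sub_le {K : Set ℂ} (hK : IsCompact K) :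
    ∃ C : ℝ≥0, ∀ (f g : Lp ℂ 2 (volume : Measure ℝ)) (c : Circle), ∀ z ∈ K,
      sobolevDensity (fun w => gaborTransform f w - (c : ℂ) * gaborTransform g w) z ≤
        C * holoDensity (fun w => bargmannTransform g w - c * bargmannTransform f w) z := by
  obtain ⟨M, hM⟩ := hK.exists_bound_of_continuousOn
    (contDiff_gaborWeight.continuous_fderiv (by simp)).continuousOn
  refine ⟨(1 + 4 * M ^ 2 + 4).toNNReal, fun f g c z hz => ?_⟩
  set h : ℂ → ℂ := fun w => bargmannTransform g w - c * bargmannTransform f w with hh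
  -- With `h = Bg - c Bf` for the entire functions `Bf`, `Bg`, the difference `Gf - c Gg` is `-c`
  -- times the conjugate of `W h`. `L` is this real-linear isometry, so only `W` and its gradient
  -- enter the constant.
  set L : ℂ →L[ℝ] ℂ := (-(c : ℂ)) • (Complex.conjCLE : ℂ →L[ℝ] ℂ) with hL
  have hLn : ∀ v, ‖L v‖ = ‖v‖ := fun v => by
    simp [hL, Circle.norm_coe]
  have hd : DifferentiableAt ℂ h z := (differentiable_bargmannTransform g z).sub
    ((differentiable_bargmannTransform f z).const_mul _)
  have hE : (fun w => gaborTransform f w - (c : ℂ) * gaborTransform g w) =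
      fun w => L (gaborWeight w • h w) := by
    ext w
    have h1 : ∀ k, gaborTransform k w =
        gaborWeight w * (starRingEnd ℂ) (bargmannTransform k w) := fun k => by
      rw [← Complex.conj_conj (gaborTransform k w), conj_gaborTransform, map_mul,
        Complex.conj_ofReal]
    have h2 : (c : ℂ) * (starRingEnd ℂ) c = 1 := by
      rw [Complex.mul_conj, Circle.normSq_coe, Complex.ofReal_one]
    simp only [hL, hh, h1, smul_apply, smul_eq_mul, Complex.real_smul,
      ContinuousLinearEquiv.coe_coe, Complex.conjCLE_apply, map_mul, map_sub, Complex.conj_ofReal]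
    linear_combination
      -gaborWeight w * (starRingEnd ℂ) (bargmannTransform f w) * h2
  have hWd : HasFDerivAt gaborWeight (fderiv ℝ gaborWeight z) z :=
    (contDiff_gaborWeight.differentiable (by simp) z).hasFDerivAt
  have hk := L.hasFDerivAt.comp z (hWd.smul (hd.hasDerivAt.hasFDerivAt.restrictScalars ℝ))
  have hW := gaborWeight_pos z
  have hder : ∀ e : ℂ, ‖e‖ = 1 →
      ‖fderiv ℝ (fun w => L (gaborWeight w • h w)) z e‖ ^ 2 ≤
        2 * ‖deriv h z‖ ^ 2 + 2 * M ^ 2 * ‖h z‖ ^ 2 := by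
    intro e he
    have h3 : ‖fderiv ℝ (fun w => L (gaborWeight w • h w)) z e‖ ≤
        ‖deriv h z‖ + M * ‖h z‖ := by
      have h4 : HasFDerivAt (fun w => L (gaborWeight w • h w)) _ z := hk
      have h5 : fderiv ℝ (fun w => L (gaborWeight w • h w)) z e =
          L (gaborWeight z • (e * deriv h z) + fderiv ℝ gaborWeight z e • h z) := by
        rw [h4.fderiv]
        rfl
      rw [h5, hLn]
      refine (norm_add_le _ _).trans (add_le_add ?_ ?_)
      · rw [norm_smul, norm_mul, he, one_mul, Real.norm_of_nonneg hW.le]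
        simpa using mul_le_mul_of_nonneg_right (gaborWeight_le_one z) (norm_nonneg (deriv h z))
      · rw [norm_smul]
        gcongr
        simpa [he] using (fderiv ℝ gaborWeight z).le_of_opNorm_le (hM z hz) e
    have h5 := pow_le_pow_left₀ (norm_nonneg _) h3 2
    nlinarith [sq_nonneg (‖deriv h z‖ - M * ‖h z‖)]
  have hval : ‖L (gaborWeight z • h z)‖ ^ 2 ≤ ‖h z‖ ^ 2 := by
    rw [hLn, norm_smul, Real.norm_of_nonneg hW.le]
    gcongr
    exact mul_le_of_le_one_left (norm_nonneg _) (gaborWeight_le_one z)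
  rw [hE, sobolevDensity_eq_ofReal, holoDensity_eq_ofReal, ← ENNReal.ofReal_coe_nnreal,
    Real.coe_toNNReal _ (by positivity), ← ENNReal.ofReal_mul (by positivity)]
  apply ENNReal.ofReal_le_ofReal
  have h6 := hder 1 (by simp)
  have h7 := hder Complex.I (by simp)
  have h8 : 0 ≤ 4 * ‖h z‖ ^ 2 + (1 + 4 * M ^ 2) * ‖deriv h z‖ ^ 2 := by positivity
  linarith

lemma contDiff_gaborTransform (f : Lp ℂ 2 (volume : Measure ℝ)) :
    ContDiff ℝ 1 (gaborTransform f) := by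
  have h : gaborTransform f =
      Complex.conjCLE ∘ fun z => (gaborWeight z : ℂ) * bargmannTransform f z := by
    ext z
    rw [Function.comp_apply, ← conj_gaborTransform]
    simp
  rw [h]
  exact Complex.conjCLE.contDiff.comp
    ((Complex.ofRealCLM.contDiff.comp (contDiff_gaborWeight.of_le (by simp))).mul
      ((differentiable_bargmannTransform f).contDiff.restrict_scalars ℝ))

lemma bargmannTransform_ne_zero_iff (f : Lp ℂ 2 (volume : Measure ℝ)) (z : ℂ) :
    bargmannTransform f z ≠ 0 ↔ gaborTransform f z ≠ 0 := by
  rw [← norm_ne_zero_iff, ← norm_ne_zero_iff (a := gaborTransform f z), norm_gaborTransform]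
  simp [(gaborWeight_pos z).ne']

lemma bargmannTransform_zero : bargmannTransform 0 = 0 := by
  ext z
  simp [bargmannTransform]

lemma frontier_nonempty_of_isBounded {Ω : Set ℂ} (hne : Ω.Nonempty)
    (hbd : Bornology.IsBounded Ω) : (frontier Ω).Nonempty := by
  rw [nonempty_frontier_iff]
  refine ⟨hne, fun h => ?_⟩
  rw [h] at hbd
  exact NoncompactSpace.noncompact_univ (X := ℂ)
    (isCompact_of_isClosed_isBounded isClosed_univ hbd)

lemma exists_circle_lintegral_sobolevDensity_le {Ω : Set ℂ} (hΩ : IsOpen Ω)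
    (hconn : IsConnected Ω) (hbd : Bornology.IsBounded Ω) (hbdry : HasContinuousBoundary Ω)
    (f : Lp ℂ 2 (volume : Measure ℝ))
    (hf : f ≠ 0 → ∀ z ∈ frontier Ω, gaborTransform f z ≠ 0) :
    ∃ C : ℝ≥0, ∀ g : Lp ℂ 2 (volume : Measure ℝ), ∃ c : Circle,
      ∫⁻ z in Ω, sobolevDensity (fun w => gaborTransform f w - (c : ℂ) * gaborTransform g w) z ≤
        C * ∫⁻ z in Ω,
          sobolevDensity (moduliDiff 1 (bargmannTransform f) (bargmannTransform g)) z := by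
  have key : ∃ C : ℝ≥0, ∀ b : ℂ → ℂ, Differentiable ℂ b → ∃ c : Circle,
      ∫⁻ z in Ω, holoDensity (fun w => b w - c * bargmannTransform f w) z ≤
        C * ∫⁻ z in Ω, sobolevDensity (moduliDiff 1 (bargmannTransform f) b) z := by
    rcases eq_or_ne f 0 with rfl | hf0
    · obtain ⟨C, hC⟩ := exists_lintegral_holoDensity_le_zero hΩ hbd
      exact ⟨C, fun b hb => ⟨1, by simpa [bargmannTransform_zero] using hC b hb⟩⟩
    · have hfr : ∀ z ∈ frontier Ω, bargmannTransform f z ≠ 0 := fun z hz =>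
        (bargmannTransform_ne_zero_iff f z).2 (hf hf0 z hz)
      have ha := differentiable_bargmannTransform f
      -- A base point `z₀` in `Ω` with `a z₀ ≠ 0` is found near a frontier point, where `a` does not
      -- vanish.
      obtain ⟨p, hp⟩ := frontier_nonempty_of_isBounded hconn.nonempty hbd
      obtain ⟨z₀, haz₀, hz₀⟩ := mem_closure_iff.1 (frontier_subset_closure hp) _
        (isOpen_ne_fun ha.continuous continuous_const) (hfr p hp)
      exact exists_circle_lintegral_holoDensity_le hΩ hbd hbdry hconn.isPreconnected ha hz₀ haz₀
        hfr
  obtain ⟨C₁, hC₁⟩ := key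
  obtain ⟨C₂, hC₂⟩ := exists_sobolevDensity_gaborTransform_sub_le hbd.isCompact_closure
  refine ⟨C₂ * C₁, fun g => ?_⟩
  obtain ⟨c, hc⟩ := hC₁ _ (differentiable_bargmannTransform g)
  refine ⟨c, ?_⟩
  rw [ENNReal.coe_mul, mul_assoc]
  refine le_trans ?_ (mul_le_mul_right hc _)
  rw [← lintegral_const_mul' _ _ ENNReal.coe_ne_top]
  exact setLIntegral_mono' hΩ.measurableSet fun z hz => hC₂ f g c z (subset_closure hz)

end GaborTransform

end

theorem mainTheorem5 (Ω : Set ℂ) (hΩ_open : IsOpen Ω) (hΩ_conn : IsConnected Ω)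
    (hΩ_bdd : Bornology.IsBounded Ω) (hΩ_bdry : HasContinuousBoundary Ω)
    (f : MeasureTheory.Lp ℂ 2 (MeasureTheory.volume : MeasureTheory.Measure ℝ))
    (hf : f ≠ 0 → ∀ z ∈ frontier Ω, gaborTransform f z ≠ 0) :
    ∃ C : NNReal, ∀ g : MeasureTheory.Lp ℂ 2 (MeasureTheory.volume : MeasureTheory.Measure ℝ),
      eH1Norm Ω (fun z => ‖gaborTransform f z‖ - ‖gaborTransform g z‖) < ⊤ ∧
      (⨅ l : Circle, eH1Norm Ω (fun z => gaborTransform f z - (l : ℂ) * gaborTransform g z)) ≤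
        (C : ENNReal) *
          eH1Norm Ω (fun z => ‖gaborTransform f z‖ - ‖gaborTransform g z‖) := by
  obtain ⟨C, hC⟩ := exists_circle_lintegral_sobolevDensity_le hΩ_open hΩ_conn hΩ_bdd hΩ_bdry f hf
  -- `C` compares squared norms.
  refine ⟨NNReal.sqrt C, fun g => ?_⟩
  have hu : (fun z => ‖gaborTransform f z‖ - ‖gaborTransform g z‖) =
      moduliDiff 1 (bargmannTransform f) (bargmannTransform g) := by
    ext z
    simp only [norm_gaborTransform, moduliDiff, one_mul, mul_sub]
  have hlip := locallyLipschitz_moduliDiff 1 (differentiable_bargmannTransform f)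
    (differentiable_bargmannTransform g)
  have hweak := hasWeakDerivOn_fderiv_of_locallyLipschitz hΩ_open hΩ_bdd hlip
  rw [hu]
  constructor
  · refine (eH1Norm_le_of_hasWeakDerivOn_fderiv hlip.continuous hweak).trans_lt ?_
    exact ENNReal.rpow_lt_top_of_nonneg (by norm_num)
      (lintegral_sobolevDensity_lt_top hΩ_open hΩ_bdd hlip).ne
  · obtain ⟨c, hc⟩ := hC g
    have hE : ContDiff ℝ 1 fun z => gaborTransform f z - (c : ℂ) * gaborTransform g z :=
      (contDiff_gaborTransform f).sub (contDiff_const.mul (contDiff_gaborTransform g))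
    refine iInf_le_of_le c ?_
    refine (eH1Norm_le_of_hasWeakDerivOn_fderiv hE.continuous
      (hasWeakDerivOn_fderiv_of_contDiff hE)).trans ?_
    refine (ENNReal.rpow_le_rpow hc (by norm_num)).trans ?_
    rw [ENNReal.mul_rpow_of_nonneg _ _ (by norm_num), NNReal.sqrt_eq_rpow,
      ENNReal.coe_rpow_of_nonneg _ (by norm_num)]
    gcongr
    exact le_eH1Norm_of_hasWeakDerivOn_fderiv hΩ_open hlip.continuous hweak
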